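/- Let $L>-1$ and $\eta<0$ be real. Put $a_{L,0}=1$, $a_{L,1}=\frac{\eta}{L+1}$, $a_{L,n}=\frac{2\eta a_{L,n-1}-a_{L,n-2}}{n(n+2L+1)}$ for $n\ge2$, let $\varphi(z)=\sum_{n\ge0}a_{L,n}z^n$ (an entire function) and let $$F_{L,\eta}(z)=C_L(\eta)\,z^{L+1}\varphi(z),\qquad C_L(\eta)=\frac{2^Le^{-\pi\eta/2}|\Gamma(L+1+i\eta)|}{\Gamma(2L+2)},$$ be the regular Coulomb wave function. Let $$f_{L,\eta}(z)=\left[C_L(\eta)^{-1}F_{L,\eta}(z)\right]^{1/(L+1)}=z\,\varphi(z)^{1/(L+1)},$$ where the branch of the power is the analytic one with $f_{L,\eta}(0)=0$, $f_{L,\eta}'(0)=1$. Let $$r^*(f_{L,\eta})=\sup\left\{r>0:\ f_{L,\eta}\text{ is analytic and }\operatorname{Re}\frac{zf_{L,\eta}'(z)}{f_{L,\eta}(z)}>0\text{ for all }|z|<r\right\}$$ be its radius of starlikeness (at $z=0$ the quotient is understood as its limit $1$). For $k\ge2$ let $$\tilde Z^{(k)}=\sum_{\tilde\rho}\frac1{\tilde\rho^{\,k}},$$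 where $\tilde\rho$ runs over the set of non-zero complex zeros of $F_{L,\eta}'(z)=C_L(\eta)z^L\left[(L+1)\varphi(z)+z\varphi'(z)\right]$. Then: 1. For every $k\ge2$ the series defining $\tilde Z^{(k)}$ converges absolutely and its sum is real. 2. For every integer $s\ge1$, $$\left(\tilde Z^{(2s)}\right)^{-1/s}<\left(r^*(f_{L,\eta})\right)^2<\frac{\tilde Z^{(2s)}}{\tilde Z^{(2s+2)}}.$$ 3. Suppose in addition that $L\neq0$. Let $\tilde p=\frac{L+2}{(L+1)^2}\eta$ and let $a_n$ be the coefficients of the power series expansion at $\rho=0$ $$\frac{2(\rho-\eta)}{\rho^2-2\eta\rho-L(L+1)}=\sum_{n\ge0}a_n\rho^n,$$ so that $a_0=\frac{2\eta}{L(L+1)}$, $a_1=-\frac{2(L^2+L+2\eta^2)}{L^2(L+1)^2}$, $a_2=\frac{2\eta(3L^2+3L+4\eta^2)}{L^3(L+1)^3}$. Then $$(2L+3)\tilde Z^{(2)}=1-La_1-\tilde pa_0+\tilde p^2,$$ $$(2L+4)\tilde Z^{(3)}=-La_2-\tilde pa_1+a_0\tilde Z^{(2)}-2\tilde p\tilde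 Z^{(2)},$$ and for every integer $n\ge0$ $$(2L+n+5)\tilde Z^{(n+4)}=-La_{n+3}-\tilde pa_{n+2}+\sum_{m=0}^{n+1}a_m\tilde Z^{(3+n-m)}+\sum_{m=0}^{n}\tilde Z^{(m+2)}\tilde Z^{(n-m+2)}-2\tilde p\tilde Z^{(n+3)}.$$ -/

import Mathlib

noncomputable section

/-- The coefficients `a_{L,n}` of the regular Coulomb wave function. -/
def coulombCoeff (L η : ℝ) : ℕ → ℝ
  | 0 => 1
  | 1 => η / (L + 1)
  | (n + 2) => (2 * η * coulombCoeff L η (n + 1) - coulombCoeff L η n) /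
      (((n : ℝ) + 2) * ((n : ℝ) + 2 + 2 * L + 1))

/-- The entire function `∑ a_{L,n} z ^ n`, so that `F_{L,η}(z) = C_L(η) z ^ (L+1) ∑ a_{L,n} z ^ n`. -/
def coulombPhi (L η : ℝ) (z : ℂ) : ℂ := ∑' n : ℕ, (coulombCoeff L η n : ℂ) * z ^ n

/-- The normalising constant `C_L(η)`. -/
def coulombC (L η : ℝ) : ℝ :=
  (2 : ℝ) ^ L * Real.exp (-(Real.pi * η) / 2) * ‖Complex.Gamma ((L : ℂ) + 1 + Complex.I * (η : ℂ))‖ /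
    Real.Gamma (2 * L + 2)

/-- The regular Coulomb wave function `F_{L,η}` (principal branch of the power). -/
def coulombF (L η : ℝ) (z : ℂ) : ℂ :=
  (coulombC L η : ℂ) * z ^ ((L : ℂ) + 1) * coulombPhi L η z

/-- The derivative `∂_z F_{L,η}`. For non-integer `L` the power has its branch cut along the
negative real axis, where some of the zeros of the derivative lie; there the derivative is
understood as the one of the analytic continuation across the cut. The product rule
gives one formula for all `z ≠ 0`; see `hasDerivAt_coulombF` and
`hasDerivWithinAt_coulombF` for the agreement with the derivative of `coulombF`. -/
def coulombFDeriv (L η : ℝ) (z : ℂ) : ℂ :=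
  (coulombC L η : ℂ) * z ^ (L : ℂ) *
    (((L : ℂ) + 1) * coulombPhi L η z + z * deriv (coulombPhi L η) z)

/-- The set of the non-zero zeros of `∂_z F_{L,η}`. -/
def coulombDerivZeros (L η : ℝ) : Set ℂ := {z | z ≠ 0 ∧ coulombFDeriv L η z = 0}

/-- The branch of `log (∑ a_{L,n} z ^ n)` that vanishes at `0`, obtained by integrating the
logarithmic derivative along the segment from `0` to `z`. -/
def coulombLogPhi (L η : ℝ) (z : ℂ) : ℂ :=
  ∫ t in (0 : ℝ)..1, z * (deriv (coulombPhi L η) ((t : ℂ) * z) / coulombPhi L η ((t : ℂ) * z))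

/-- The normalised function `f_{L,η}(z) = [C_L(η)⁻¹ F_{L,η}(z)] ^ (1/(L+1))`, with the branch of
the power that is analytic at `0` and satisfies `f(0) = 0`, `f'(0) = 1`, that is
`f_{L,η}(z) = z (∑ a_{L,n} z ^ n) ^ (1/(L+1))`; see `coulombf_spec`. -/
def coulombf (L η : ℝ) (z : ℂ) : ℂ := z * Complex.exp (coulombLogPhi L η z / ((L : ℂ) + 1))

/-- The radius of starlikeness of order `β`: the supremum of all `r > 0` such that `f` is analytic
in the disk of radius `r` about `0` and `Re (z f'(z) / f(z)) > β` there (at `z = 0` the quotient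
has the limit `1` for a normalised function, so the origin imposes no condition). -/
def starlikeRadius (β : ℝ) (f : ℂ → ℂ) : ℝ :=
  sSup {r : ℝ | 0 < r ∧ DifferentiableOn ℂ f (Metric.ball 0 r) ∧
    ∀ z ∈ Metric.ball (0 : ℂ) r, z ≠ 0 → β < (z * deriv f z / f z).re}

/-- The coefficients of the formal power series of
`2 (ρ - η) / (ρ ^ 2 - 2 η ρ - L (L + 1))` in `ρ` (for `L (L + 1) ≠ 0`). -/
def genCoeff (L η : ℝ) (n : ℕ) : ℝ :=
  PowerSeries.coeff n
    ((2 * (PowerSeries.X - PowerSeries.C η) : PowerSeries ℝ) *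
      (PowerSeries.X ^ 2 - PowerSeries.C (2 * η) * PowerSeries.X
        - PowerSeries.C (L * (L + 1)) : PowerSeries ℝ)⁻¹)

/-- The number `p̃`. -/
def coulombP (L η : ℝ) : ℝ := (L + 2) / (L + 1) ^ 2 * η

lemma coulombCoeff_bound {L : ℝ} (hL : -1 < L) (η : ℝ) (n : ℕ) :
    |coulombCoeff L η n| ≤ (2 * |η| + 1 + |η| / (L + 1)) ^ n / (n.factorial : ℝ) := by
  have hL1 : 0 < L + 1 := by linarith
  have hη : 0 ≤ |η| := abs_nonneg η
  have hq : 0 ≤ |η| / (L + 1) := by positivity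
  set K : ℝ := 2 * |η| + 1 + |η| / (L + 1) with hK
  have hK1 : 1 ≤ K := by linarith
  have hK2 : 2 * |η| * K + 1 ≤ K ^ 2 := by nlinarith
  induction n using Nat.strong_induction_on with
  | _ n ih =>
    match n with
    | 0 => simp [coulombCoeff]
    | 1 =>
      simp only [coulombCoeff, abs_div, abs_of_pos hL1, pow_one, Nat.factorial_one, Nat.cast_one,
        div_one]
      linarith
    | (m + 2) =>
      have h1 := ih (m + 1) (by omega)
      have h0 := ih m (by omega)
      have hm : (0 : ℝ) ≤ m := Nat.cast_nonneg m
      have hden : 0 < ((m : ℝ) + 2) * ((m : ℝ) + 2 + 2 * L + 1) := by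
        apply mul_pos <;> linarith
      have hf : (0 : ℝ) < (m.factorial : ℝ) := by exact_mod_cast Nat.factorial_pos m
      rw [coulombCoeff, abs_div, abs_of_pos hden, div_le_iff₀ hden]
      have hnum : |2 * η * coulombCoeff L η (m + 1) - coulombCoeff L η m| ≤
          2 * |η| * (K ^ (m + 1) / ((m + 1).factorial : ℝ)) + K ^ m / (m.factorial : ℝ) := by
        refine (abs_sub _ _).trans ?_
        rw [abs_mul, abs_mul, abs_two]
        gcongr
      refine hnum.trans ?_
      have hKm : 0 < K ^ m := by positivity
      have e1 : (((m + 1).factorial : ℕ) : ℝ) = ((m : ℝ) + 1) * m.factorial := by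
        rw [Nat.factorial_succ]; push_cast; ring
      have e2 : (((m + 2).factorial : ℕ) : ℝ) = ((m : ℝ) + 2) * (((m : ℝ) + 1) * m.factorial) := by
        rw [Nat.factorial_succ, Nat.factorial_succ]; push_cast; ring
      have step : K ^ (m + 2) / ((m + 2).factorial : ℝ) *
          (((m : ℝ) + 2) * ((m : ℝ) + 1)) ≤ K ^ (m + 2) / ((m + 2).factorial : ℝ) *
          (((m : ℝ) + 2) * ((m : ℝ) + 2 + 2 * L + 1)) := by
        gcongr
        linarith
      refine le_trans ?_ step
      have e3 : K ^ (m + 2) / ((m + 2).factorial : ℝ) * (((m : ℝ) + 2) * ((m : ℝ) + 1)) =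
          K ^ m * K ^ 2 / (m.factorial : ℝ) := by
        rw [e2, pow_add]; field_simp
      have e4 : 2 * |η| * (K ^ (m + 1) / ((m + 1).factorial : ℝ)) + K ^ m / (m.factorial : ℝ) ≤
          K ^ m * (2 * |η| * K + 1) / (m.factorial : ℝ) := by
        have : K ^ (m + 1) / ((m + 1).factorial : ℝ) ≤ K ^ (m + 1) / (m.factorial : ℝ) := by
          rw [e1]
          gcongr
          nlinarith
        calc _ ≤ 2 * |η| * (K ^ (m + 1) / (m.factorial : ℝ)) + K ^ m / (m.factorial : ℝ) := by
              gcongr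
          _ = _ := by rw [pow_succ]; ring
      rw [e3]
      refine e4.trans ?_
      gcongr

lemma differentiable_coulombPhi {L : ℝ} (hL : -1 < L) (η : ℝ) :
    Differentiable ℂ (coulombPhi L η) := by
  intro z
  set K : ℝ := 2 * |η| + 1 + |η| / (L + 1) with hK
  have hL1 : 0 < L + 1 := by linarith
  have hK0 : 0 ≤ K := by positivity
  set R : ℝ := ‖z‖ + 1 with hR
  have hR0 : 0 ≤ R := by positivity
  have hz : z ∈ Metric.ball (0 : ℂ) R := by simp [hR]
  have hsum : Summable (fun n : ℕ => (K * R) ^ n / (n.factorial : ℝ)) :=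
    Real.summable_pow_div_factorial (K * R)
  have hd : DifferentiableOn ℂ (fun w : ℂ => ∑' n : ℕ, (coulombCoeff L η n : ℂ) * w ^ n)
      (Metric.ball 0 R) := by
    refine Complex.differentiableOn_tsum_of_summable_norm hsum ?_ Metric.isOpen_ball ?_
    · intro n
      fun_prop
    · intro n w hw
      have hw' : ‖w‖ ≤ R := by
        have := Metric.mem_ball.1 hw
        rw [dist_zero_right] at this
        exact this.le
      rw [norm_mul, norm_pow, Complex.norm_real, Real.norm_eq_abs]
      calc |coulombCoeff L η n| * ‖w‖ ^ n ≤ K ^ n / (n.factorial : ℝ) * R ^ n := by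
            gcongr
            exact coulombCoeff_bound hL η n
        _ = _ := by rw [mul_pow]; ring
  exact hd.differentiableAt (Metric.isOpen_ball.mem_nhds hz)

lemma coulombPhi_zero (L η : ℝ) : coulombPhi L η 0 = 1 := by
  unfold coulombPhi
  rw [tsum_eq_single 0]
  · simp [coulombCoeff]
  · intro n hn
    simp [hn]

/-- Off the branch cut `coulombFDeriv` is the derivative of `coulombF`. -/
lemma hasDerivAt_coulombF {L : ℝ} (hL : -1 < L) (η : ℝ) {z : ℂ} (hz : z ∈ Complex.slitPlane) :
    HasDerivAt (coulombF L η) (coulombFDeriv L η z) z := by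
  have h1 : HasDerivAt (fun w : ℂ => w ^ ((L : ℂ) + 1))
      (((L : ℂ) + 1) * z ^ ((L : ℂ) + 1 - 1) * 1) z := (hasDerivAt_id z).cpow_const hz
  have h2 := (differentiable_coulombPhi hL η z).hasDerivAt
  have h3 := (h1.const_mul (coulombC L η : ℂ)).mul h2
  have hz0 : z ≠ 0 := Complex.slitPlane_ne_zero hz
  refine h3.congr_deriv ?_
  rw [add_sub_cancel_right, coulombFDeriv, Complex.cpow_add _ _ hz0, Complex.cpow_one]
  ring

/-- On the branch cut `coulombFDeriv` is the derivative of `coulombF` from the side of the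
upper half-plane, which is the one on which the principal branch is continuous. -/
lemma hasDerivWithinAt_coulombF {L : ℝ} (hL : -1 < L) (η : ℝ) {z : ℂ} (hre : z.re < 0)
    (him : 0 ≤ z.im) :
    HasDerivWithinAt (coulombF L η) (coulombFDeriv L η z) {w : ℂ | 0 ≤ w.im} z := by
  have key : ∀ w : ℂ, w.re < 0 → 0 ≤ w.im → ∀ a : ℂ,
      w ^ a = Complex.exp (Real.pi * Complex.I * a) * (-w) ^ a := by
    intro w hw1 hw2 a
    have hw0 : w ≠ 0 := by
      rintro rfl
      simp at hw1
    have harg : (-w).arg = w.arg - Real.pi := by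
      rw [Complex.arg_neg_eq_arg_sub_pi_iff]
      rcases hw2.lt_or_eq with h | h
      · exact Or.inl h
      · exact Or.inr ⟨h.symm, hw1⟩
    rw [Complex.cpow_def_of_ne_zero hw0, Complex.cpow_def_of_ne_zero (neg_ne_zero.2 hw0),
      ← Complex.exp_add]
    congr 1
    rw [Complex.log, Complex.log, harg, norm_neg]
    push_cast
    ring
  have hz0 : z ≠ 0 := by
    rintro rfl
    simp at hre
  have hslit : -z ∈ Complex.slitPlane := by
    left
    simpa using hre
  have h1 : HasDerivAt (fun w : ℂ => (-w) ^ ((L : ℂ) + 1))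
      (((L : ℂ) + 1) * (-z) ^ ((L : ℂ) + 1 - 1) * (-1)) z :=
    (hasDerivAt_neg z).cpow_const hslit
  have h2 := (differentiable_coulombPhi hL η z).hasDerivAt
  have h3 := ((h1.const_mul (Complex.exp (Real.pi * Complex.I * ((L : ℂ) + 1)))).const_mul
    (coulombC L η : ℂ)).mul h2
  have hev : ∀ w : ℂ, w.re < 0 → 0 ≤ w.im → coulombF L η w =
      (coulombC L η : ℂ) * (Complex.exp (Real.pi * Complex.I * ((L : ℂ) + 1)) *
        (-w) ^ ((L : ℂ) + 1)) * coulombPhi L η w := by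
    intro w hw1 hw2
    rw [coulombF, key w hw1 hw2]
  have hE : coulombF L η =ᶠ[nhdsWithin z {w : ℂ | 0 ≤ w.im}] fun w =>
      (coulombC L η : ℂ) * (Complex.exp (Real.pi * Complex.I * ((L : ℂ) + 1)) *
        (-w) ^ ((L : ℂ) + 1)) * coulombPhi L η w := by
    have hopen : {w : ℂ | w.re < 0} ∈ nhds z :=
      (isOpen_lt Complex.continuous_re continuous_const).mem_nhds hre
    filter_upwards [mem_nhdsWithin_of_mem_nhds hopen, self_mem_nhdsWithin] with w hw1 hw2
    exact hev w hw1 hw2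
  have h4 := (h3.hasDerivWithinAt (s := {w : ℂ | 0 ≤ w.im})).congr_of_eventuallyEq hE
    (hev z hre him)
  refine h4.congr_deriv ?_
  have e1 : Complex.exp (Real.pi * Complex.I * ((L : ℂ) + 1)) =
      -Complex.exp (Real.pi * Complex.I * (L : ℂ)) := by
    rw [mul_add, mul_one, Complex.exp_add, Complex.exp_pi_mul_I]
    ring
  rw [add_sub_cancel_right, coulombFDeriv, key z hre him, e1,
    Complex.cpow_add _ _ (neg_ne_zero.2 hz0), Complex.cpow_one]
  ring

/-- On every disk about `0` in which `∑ a_{L,n} z ^ n` has no zero, `coulombLogPhi` is the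
analytic branch of its logarithm that vanishes at `0`. -/
lemma coulombLogPhi_spec {L : ℝ} (hL : -1 < L) (η : ℝ) {R : ℝ} (hR : 0 < R)
    (hne : ∀ z ∈ Metric.ball (0 : ℂ) R, coulombPhi L η z ≠ 0) :
    DifferentiableOn ℂ (coulombLogPhi L η) (Metric.ball 0 R) ∧ coulombLogPhi L η 0 = 0 ∧
      ∀ z ∈ Metric.ball (0 : ℂ) R, Complex.exp (coulombLogPhi L η z) = coulombPhi L η z := by
  have hφ := differentiable_coulombPhi hL η
  have hφ' : Differentiable ℂ (deriv (coulombPhi L η)) :=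
    (hφ.contDiff (n := 2)).differentiable_deriv_two
  have hq : DifferentiableOn ℂ (fun z => deriv (coulombPhi L η) z / coulombPhi L η z)
      (Metric.ball 0 R) := hφ'.differentiableOn.div hφ.differentiableOn hne
  obtain ⟨g₀, hg₀⟩ := hq.isExactOn_ball
  set g : ℂ → ℂ := fun z => g₀ z - g₀ 0 with hg
  have hgd : ∀ z ∈ Metric.ball (0 : ℂ) R,
      HasDerivAt g (deriv (coulombPhi L η) z / coulombPhi L η z) z := fun z hz =>
    (hg₀ z hz).sub_const _
  have hg0 : g 0 = 0 := by simp [hg]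
  have hmem : ∀ z ∈ Metric.ball (0 : ℂ) R, ∀ t ∈ Set.Icc (0 : ℝ) 1,
      (t : ℂ) * z ∈ Metric.ball (0 : ℂ) R := by
    intro z hz t ht
    rw [Metric.mem_ball, dist_zero_right] at hz ⊢
    rw [norm_mul, Complex.norm_real, Real.norm_eq_abs, abs_of_nonneg ht.1]
    nlinarith [norm_nonneg z, ht.2]
  have hEq : ∀ z ∈ Metric.ball (0 : ℂ) R, coulombLogPhi L η z = g z := by
    intro z hz
    have hder : ∀ t ∈ Set.uIcc (0 : ℝ) 1, HasDerivAt (fun t : ℝ => g ((t : ℂ) * z))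
        (z * (deriv (coulombPhi L η) ((t : ℂ) * z) / coulombPhi L η ((t : ℂ) * z))) t := by
      intro t ht
      rw [Set.uIcc_of_le zero_le_one] at ht
      have h1 := hgd _ (hmem z hz t ht)
      have h2 : HasDerivAt (fun s : ℂ => s * z) z (t : ℂ) := by
        simpa using (hasDerivAt_id (t : ℂ)).mul_const z
      have h3 := (HasDerivAt.comp (t : ℂ) h1 h2).comp_ofReal
      rw [mul_comm]
      exact h3
    have hcont : ContinuousOn (fun t : ℝ =>
        z * (deriv (coulombPhi L η) ((t : ℂ) * z) / coulombPhi L η ((t : ℂ) * z)))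
        (Set.uIcc (0 : ℝ) 1) := by
      rw [Set.uIcc_of_le zero_le_one]
      refine continuousOn_const.mul ?_
      refine hq.continuousOn.comp (f := fun t : ℝ => (t : ℂ) * z) ?_ (fun t ht => hmem z hz t ht)
      fun_prop
    rw [coulombLogPhi, intervalIntegral.integral_eq_sub_of_hasDerivAt hder
      hcont.intervalIntegrable]
    simp [hg0]
  have h0 : (0 : ℂ) ∈ Metric.ball (0 : ℂ) R := by simpa using hR
  refine ⟨?_, ?_, ?_⟩
  · intro z hz
    exact ((hgd z hz).differentiableAt.differentiableWithinAt).congr hEq (hEq z hz)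
  · rw [hEq 0 h0, hg0]
  · intro z hz
    rw [hEq z hz]
    have hconst : ∀ w ∈ Metric.ball (0 : ℂ) R,
        HasDerivWithinAt (fun w => coulombPhi L η w * Complex.exp (-g w)) 0
          (Metric.ball (0 : ℂ) R) w := by
      intro w hw
      have h1 := (hφ w).hasDerivAt.mul ((hgd w hw).neg.cexp)
      refine (h1.congr_deriv ?_).hasDerivWithinAt
      have := hne w hw
      field_simp
      ring
    have hc := (convex_ball (0 : ℂ) R).norm_image_sub_le_of_norm_hasDerivWithin_le (C := 0)
      hconst (by simp) h0 hz
    rw [zero_mul] at hc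
    have hc' := sub_eq_zero.1 (norm_le_zero_iff.1 hc)
    simp only [hg0, coulombPhi_zero, neg_zero, Complex.exp_zero, mul_one] at hc'
    rw [Complex.exp_neg] at hc'
    have hexp := Complex.exp_ne_zero (g z)
    field_simp at hc'
    exact hc'.symm

/-- On every such disk `coulombf` is analytic and normalised, where
`f(z) = z exp(g(z) / (L+1))` with `g` the branch of the logarithm of `∑ a_{L,n} z ^ n`. See
`coulombLogPhi_spec` for the latter. -/
lemma coulombf_spec {L : ℝ} (hL : -1 < L) (η : ℝ) {R : ℝ} (hR : 0 < R)
    (hne : ∀ z ∈ Metric.ball (0 : ℂ) R, coulombPhi L η z ≠ 0) :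
    DifferentiableOn ℂ (coulombf L η) (Metric.ball 0 R) ∧ coulombf L η 0 = 0 ∧
      deriv (coulombf L η) 0 = 1 := by
  obtain ⟨h1, h2, -⟩ := coulombLogPhi_spec hL η hR hne
  have h0 : (0 : ℂ) ∈ Metric.ball (0 : ℂ) R := by simpa using hR
  refine ⟨differentiableOn_id.mul (h1.div_const _).cexp, by simp [coulombf], ?_⟩
  have h3 := (h1.differentiableAt (Metric.isOpen_ball.mem_nhds h0)).hasDerivAt
  have h4 := (hasDerivAt_id (0 : ℂ)).mul ((h3.div_const ((L : ℂ) + 1)).cexp)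
  have h5 : HasDerivAt (coulombf L η) _ 0 := h4
  rw [h5.deriv]
  simp [h2]

lemma coulombC_pos {L : ℝ} (hL : -1 < L) (η : ℝ) : 0 < coulombC L η := by
  have h1 : 0 < Real.Gamma (2 * L + 2) := Real.Gamma_pos_of_pos (by linarith)
  have h2 : Complex.Gamma ((L : ℂ) + 1 + Complex.I * (η : ℂ)) ≠ 0 := by
    apply Complex.Gamma_ne_zero_of_re_pos
    simp
    linarith
  have h3 := norm_pos_iff.2 h2
  unfold coulombC
  positivity

end

noncomputable section

open Filter Topology

/-! Write `φ` for `coulombPhi` and `G = (L+1)φ + zφ'`. Then `F' = C z^L G` and `z f'/f =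
G/((L+1)φ)`, so the zeros `ρ̃` are exactly those of `G`, and they also control starlikeness.
Everything rests on the equation `zφ'' + (2L+2)φ' + (z-2η)φ = 0`.

Zeros. Multiplied by the integrating factor `t^(2L+2)` and followed along the segment from `0` to
`w`, two quadratic expressions in `φ, φ'` become strictly monotone in an averaged sense. One yields
the sign of `Im(φ'/φ)` (`im_mul_im_deriv_coulombPhi_neg`), which makes the zeros of `G` real. The
other yields a strict Laguerre inequality (`coulombPhi_laguerre`), which makes them simple.

Power sums. `G` has exponential type. Dividing out its zeros in `|z| < R` and applying
Borel–Carathéodory to the logarithm of the rest shows that the Taylor coefficients `Y_k` of `Y =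
-G'/G` are `∑ 1/ρ̃^(k+1)` for `k ≥ 1` (`hasSum_inv_zeros`), while `Y_0 = -p̃`. Eliminating `φ` from
the differential equation gives a Riccati equation for `Y` (`coulombLogSeries_riccati`). For `L ≠ 0`
it can be divided by `ρ² - 2ηρ - L(L+1)`, and comparison of coefficients gives the recurrences.

Radius. Since `η < 0`, the Riccati equation for `-zφ'/φ` forces nonnegative Taylor coefficients, so
`|zφ'/φ|` is at most its value at `|z|`. Hence `Re(z f'/f) > 0` up to the smallest modulus of a zero
of `G`, where the quotient vanishes; `φ` has no zero in that closed disk. So `r*` is that modulus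
(`starlikeRadius_coulombf`).

Inequalities. As `ρ̃² = |ρ̃|²`, part 2 is the Euler–Rayleigh comparison of positive sums with their
largest term. Strictness needs a zero of larger modulus: if all zeros had the same square, `Y` would
be rational, and the leading coefficient of the Riccati equation would read `b² + 1 = 0` with `b`
real (`exists_coulombG_zero_sq_ne`). -/

/-! ### Calculus of Taylor series at the origin -/

/-- The Taylor series at the origin, as a formal power series. -/
def taylorAtZero (f : ℂ → ℂ) : PowerSeries ℂ :=
  PowerSeries.mk fun n => iteratedDeriv n f 0 / (n.factorial : ℂ)

lemma coeff_taylorAtZero (f : ℂ → ℂ) (n : ℕ) :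
    PowerSeries.coeff n (taylorAtZero f) = iteratedDeriv n f 0 / (n.factorial : ℂ) :=
  PowerSeries.coeff_mk _ _

lemma taylorAtZero_of_hasSum {f : ℂ → ℂ} {c : ℕ → ℂ}
    (h : ∀ᶠ z in 𝓝 (0 : ℂ), HasSum (fun n => c n * z ^ n) (f z)) :
    taylorAtZero f = PowerSeries.mk c := by
  have h1 : HasFPowerSeriesAt f (FormalMultilinearSeries.ofScalars ℂ c) 0 := by
    rw [hasFPowerSeriesAt_iff]
    filter_upwards [h] with z hz
    simpa [FormalMultilinearSeries.coeff_ofScalars, mul_comm] using hz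
  have h2 := h1.eq_formalMultilinearSeries h1.analyticAt.hasFPowerSeriesAt
  have h3 := FormalMultilinearSeries.ofScalars_series_injective ℂ ℂ h2
  rw [taylorAtZero, ← h3]

lemma taylorAtZero_congr {f g : ℂ → ℂ} (h : f =ᶠ[𝓝 0] g) : taylorAtZero f = taylorAtZero g := by
  ext n
  rw [coeff_taylorAtZero, coeff_taylorAtZero, h.iteratedDeriv_eq n]

lemma taylorAtZero_mul {f g : ℂ → ℂ} (hf : AnalyticAt ℂ f 0) (hg : AnalyticAt ℂ g 0) :
    taylorAtZero (fun z => f z * g z) = taylorAtZero f * taylorAtZero g := by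
  ext n
  rw [coeff_taylorAtZero, PowerSeries.coeff_mul, iteratedDeriv_fun_mul hf.contDiffAt hg.contDiffAt,
    Finset.Nat.sum_antidiagonal_eq_sum_range_succ_mk, Finset.sum_div]
  refine Finset.sum_congr rfl fun i hi => ?_
  have hi' : i ≤ n := Nat.lt_succ_iff.1 (Finset.mem_range.1 hi)
  rw [coeff_taylorAtZero, coeff_taylorAtZero, Nat.cast_choose ℂ hi']
  have h1 : (n.factorial : ℂ) ≠ 0 := by exact_mod_cast n.factorial_ne_zero
  field_simp

lemma taylorAtZero_add {f g : ℂ → ℂ} (hf : AnalyticAt ℂ f 0) (hg : AnalyticAt ℂ g 0) :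
    taylorAtZero (fun z => f z + g z) = taylorAtZero f + taylorAtZero g := by
  ext n
  rw [map_add, coeff_taylorAtZero, coeff_taylorAtZero, coeff_taylorAtZero, ← add_div,
    iteratedDeriv_fun_add hf.contDiffAt hg.contDiffAt]

lemma taylorAtZero_const (c : ℂ) : taylorAtZero (fun _ => c) = PowerSeries.C c := by
  ext n
  rw [coeff_taylorAtZero, iteratedDeriv_const, PowerSeries.coeff_C]
  split_ifs with h
  · simp [h]
  · simp

lemma taylorAtZero_id : taylorAtZero (fun z => z) = PowerSeries.X := by
  ext n
  rw [coeff_taylorAtZero, iteratedDeriv_fun_id_zero, PowerSeries.coeff_X]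
  split_ifs with h
  · simp [h]
  · simp

lemma taylorAtZero_deriv (f : ℂ → ℂ) :
    taylorAtZero (deriv f) = PowerSeries.derivative ℂ (taylorAtZero f) := by
  ext n
  rw [coeff_taylorAtZero, PowerSeries.coeff_derivative, coeff_taylorAtZero, iteratedDeriv_succ',
    Nat.factorial_succ]
  have h1 : (n.factorial : ℂ) ≠ 0 := by exact_mod_cast n.factorial_ne_zero
  have h2 : (n : ℂ) + 1 ≠ 0 := by exact_mod_cast n.succ_ne_zero
  push_cast
  field_simp

lemma hasSum_taylorAtZero {f : ℂ → ℂ} {r : ℝ} (hf : DifferentiableOn ℂ f (Metric.ball 0 r)) {z : ℂ}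
    (hz : z ∈ Metric.ball 0 r) :
    HasSum (fun n => PowerSeries.coeff n (taylorAtZero f) * z ^ n) (f z) := by
  have h := Complex.hasSum_taylorSeries_on_ball hf hz
  refine h.congr_fun fun n => ?_
  rw [coeff_taylorAtZero]
  simp only [smul_eq_mul, sub_zero]
  ring

lemma eq_of_taylorAtZero_eq {f g : ℂ → ℂ} (hf : Differentiable ℂ f) (hg : Differentiable ℂ g)
    (h : taylorAtZero f = taylorAtZero g) : f = g := by
  ext z
  have hz : z ∈ Metric.ball (0 : ℂ) (‖z‖ + 1) := by simp
  have h1 := hasSum_taylorAtZero hf.differentiableOn hz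
  rw [h] at h1
  exact h1.unique (hasSum_taylorAtZero hg.differentiableOn hz)

/-! ### The differential equation of `φ` and the function `G` -/

section Coulomb

variable {L η : ℝ}

open PowerSeries

/-- The power series `∑ a_{L,n} X ^ n`. -/
def coulombSeries (L η : ℝ) : PowerSeries ℝ := PowerSeries.mk (coulombCoeff L η)

/-- The entire function `(L + 1) φ + z φ'`, which is `F'` without the factor `C z ^ L`. -/
def coulombG (L η : ℝ) (z : ℂ) : ℂ :=
  ((L : ℂ) + 1) * coulombPhi L η z + z * deriv (coulombPhi L η) z

/-- The power series of `coulombG`. -/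
def coulombGSeries (L η : ℝ) : PowerSeries ℝ :=
  C (L + 1) * coulombSeries L η + X * derivative ℝ (coulombSeries L η)

lemma hasSum_coulombPhi (hL : -1 < L) (z : ℂ) :
    HasSum (fun n => (coulombCoeff L η n : ℂ) * z ^ n) (coulombPhi L η z) := by
  refine Summable.hasSum (Summable.of_norm_bounded
    (Real.summable_pow_div_factorial ((2 * |η| + 1 + |η| / (L + 1)) * ‖z‖)) fun n => ?_)
  rw [norm_mul, norm_pow, Complex.norm_real, Real.norm_eq_abs, mul_pow, mul_div_right_comm]
  gcongr
  exact coulombCoeff_bound hL η n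

lemma taylorAtZero_coulombPhi (hL : -1 < L) :
    taylorAtZero (coulombPhi L η) = PowerSeries.map Complex.ofRealHom (coulombSeries L η) := by
  rw [taylorAtZero_of_hasSum (Eventually.of_forall (hasSum_coulombPhi hL))]
  ext n
  simp [coulombSeries]

lemma differentiable_deriv_coulombPhi (hL : -1 < L) :
    Differentiable ℂ (deriv (coulombPhi L η)) :=
  ((differentiable_coulombPhi hL η).contDiff (n := 2)).differentiable_deriv_two

lemma differentiable_coulombG (hL : -1 < L) : Differentiable ℂ (coulombG L η) :=
  ((differentiable_coulombPhi hL η).const_mul _).add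
    (differentiable_id.mul (differentiable_deriv_coulombPhi hL))

lemma coulombG_zero : coulombG L η 0 = (L : ℂ) + 1 := by
  simp [coulombG, coulombPhi_zero]

lemma map_derivative (f : PowerSeries ℝ) :
    PowerSeries.map Complex.ofRealHom (derivative ℝ f) =
      derivative ℂ (PowerSeries.map Complex.ofRealHom f) := by
  ext n
  simp [coeff_derivative]

lemma taylorAtZero_coulombG (hL : -1 < L) :
    taylorAtZero (coulombG L η) = PowerSeries.map Complex.ofRealHom (coulombGSeries L η) := by
  have h1 := (differentiable_coulombPhi hL η).analyticAt 0
  have h2 := (differentiable_deriv_coulombPhi (η := η) hL).analyticAt 0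
  unfold coulombG coulombGSeries
  rw [taylorAtZero_add (by fun_prop) (by fun_prop), taylorAtZero_mul (by fun_prop) (by fun_prop),
    taylorAtZero_mul (by fun_prop) (by fun_prop), taylorAtZero_const, taylorAtZero_id,
    taylorAtZero_deriv, taylorAtZero_coulombPhi hL]
  simp [map_derivative]

/-- This is the three-term recurrence of the `a_{L,n}`, read coefficient by coefficient. The
constant coefficient encodes the value of `a_{L,1}`. -/
lemma coulombSeries_ode (hL : -1 < L) :
    X * derivative ℝ (derivative ℝ (coulombSeries L η))
      + C (2 * L + 2) * derivative ℝ (coulombSeries L η)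
      + (X - C (2 * η)) * coulombSeries L η = 0 := by
  have hL1 : L + 1 ≠ 0 := by linarith
  ext n
  rw [sub_mul, map_add, map_add, map_sub, coeff_C_mul, coeff_C_mul, coeff_derivative]
  rcases n with _ | n
  · simp [coeff_zero_X_mul, coulombSeries, coulombCoeff]
    field_simp
    ring
  · have hn : (0 : ℝ) ≤ n := n.cast_nonneg
    have h1 : (n : ℝ) + 2 ≠ 0 := by positivity
    have h2 : (n : ℝ) + 2 + 2 * L + 1 ≠ 0 := by nlinarith
    simp only [coeff_succ_X_mul, coeff_derivative, coulombSeries, coeff_mk, coulombCoeff]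
    push_cast
    simp only [map_zero]
    field_simp
    ring

lemma coulombPhi_ode (hL : -1 < L) (z : ℂ) :
    z * deriv (deriv (coulombPhi L η)) z + (2 * L + 2) * deriv (coulombPhi L η) z
      + (z - 2 * η) * coulombPhi L η z = 0 := by
  have hd := differentiable_coulombPhi hL η
  have hd1 := differentiable_deriv_coulombPhi (η := η) hL
  have hd2 : Differentiable ℂ (deriv (deriv (coulombPhi L η))) :=
    (hd1.contDiff (n := 2)).differentiable_deriv_two
  have h0 := hd.analyticAt 0
  have h1 := hd1.analyticAt 0
  have h2 := hd2.analyticAt 0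
  refine congrFun (eq_of_taylorAtZero_eq (f := fun z => z * deriv (deriv (coulombPhi L η)) z
    + (2 * L + 2) * deriv (coulombPhi L η) z + (z - 2 * η) * coulombPhi L η z) (g := fun _ => 0)
    (by fun_prop) (by fun_prop) ?_) z
  simp only [sub_eq_add_neg]
  rw [taylorAtZero_add (by fun_prop) (by fun_prop), taylorAtZero_add (by fun_prop) (by fun_prop),
    taylorAtZero_mul (by fun_prop) (by fun_prop), taylorAtZero_mul (by fun_prop) (by fun_prop),
    taylorAtZero_mul (by fun_prop) (by fun_prop), taylorAtZero_const (2 * (L : ℂ) + 2),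
    taylorAtZero_add (by fun_prop) (by fun_prop), taylorAtZero_const, taylorAtZero_id,
    taylorAtZero_deriv, taylorAtZero_deriv, taylorAtZero_coulombPhi hL, taylorAtZero_const]
  have h := congrArg (PowerSeries.map Complex.ofRealHom) (coulombSeries_ode (η := η) hL)
  simpa [map_derivative, sub_eq_add_neg] using h

/-- The differential equation removes `zφ''`, so `G` and `G'` are both linear in `(φ, φ')`; a common
zero then becomes a condition on these two values only. -/
lemma deriv_coulombG (hL : -1 < L) (z : ℂ) :
    deriv (coulombG L η) z = -L * deriv (coulombPhi L η) z - (z - 2 * η) * coulombPhi L η z := by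
  have h0 := (differentiable_coulombPhi hL η z).hasDerivAt
  have h1 := (differentiable_deriv_coulombPhi (η := η) hL z).hasDerivAt
  have h : HasDerivAt (coulombG L η) _ z :=
    (h0.const_mul ((L : ℂ) + 1)).add ((hasDerivAt_id z).mul h1)
  rw [h.deriv]
  simp only [id]
  linear_combination coulombPhi_ode (η := η) hL z

lemma derivative_coulombGSeries (hL : -1 < L) :
    derivative ℝ (coulombGSeries L η) = -C L * derivative ℝ (coulombSeries L η)
      - (X - C (2 * η)) * coulombSeries L η := by
  have h := coulombSeries_ode (η := η) hL
  simp only [coulombGSeries, map_add, Derivation.leibniz, derivative_C, derivative_X, smul_eq_mul,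
    map_mul, map_one, map_ofNat, Derivation.map_one_eq_zero] at h ⊢
  linear_combination h

end Coulomb

/-! ### The zeros of `G` are real and simple -/

/-- A nonincreasing `f` that starts at `0` and does not end below `0` vanishes identically; then `g
= 0` on `(0,1)`, against `g 0 > 0`. The derivative is required only inside the interval because `t ^
a` need not be differentiable at `0`. -/
lemma neg_of_hasDerivAt_neg_rpow_mul {f g : ℝ → ℝ} {a : ℝ} (hf : ContinuousOn f (Set.Icc 0 1))
    (hf0 : f 0 = 0) (hg : Continuous g) (hg0 : 0 < g 0) (hgn : ∀ t, 0 ≤ g t)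
    (hd : ∀ t ∈ Set.Ioo (0 : ℝ) 1, HasDerivAt f (-(t ^ a * g t)) t) : f 1 < 0 := by
  have hanti : AntitoneOn f (Set.Icc 0 1) := by
    refine antitoneOn_of_deriv_nonpos (convex_Icc 0 1) hf ?_ ?_
    · rw [interior_Icc]
      exact fun t ht => (hd t ht).differentiableAt.differentiableWithinAt
    · rw [interior_Icc]
      intro t ht
      rw [(hd t ht).deriv]
      have := Real.rpow_nonneg ht.1.le a
      have := mul_nonneg this (hgn t)
      linarith
  have h0 : (0 : ℝ) ∈ Set.Icc (0 : ℝ) 1 := by simp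
  have h1 : (1 : ℝ) ∈ Set.Icc (0 : ℝ) 1 := by simp
  by_contra hcon
  have hzero : ∀ t ∈ Set.Icc (0 : ℝ) 1, f t = 0 := fun t ht =>
    le_antisymm (hf0 ▸ hanti h0 ht ht.1) ((not_lt.1 hcon).trans (hanti ht h1 ht.2))
  have hg' : ∀ t ∈ Set.Ioo (0 : ℝ) 1, g t = 0 := by
    intro t ht
    have he : f =ᶠ[𝓝 t] fun _ => 0 := by
      filter_upwards [Ioo_mem_nhds ht.1 ht.2] with s hs
      exact hzero s ⟨hs.1.le, hs.2.le⟩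
    have h2 := (hd t ht).unique ((hasDerivAt_const t (0 : ℝ)).congr_of_eventuallyEq he)
    have h3 : t ^ a ≠ 0 := (Real.rpow_pos_of_pos ht.1 a).ne'
    simpa [h3] using h2
  have hlim : Tendsto g (𝓝[>] 0) (𝓝 (g 0)) := (hg.tendsto 0).mono_left nhdsWithin_le_nhds
  have hlim0 : Tendsto g (𝓝[>] 0) (𝓝 0) := by
    refine tendsto_const_nhds.congr' ?_
    filter_upwards [Ioo_mem_nhdsGT (zero_lt_one' ℝ)] with t ht
    exact (hg' t ht).symm
  exact hg0.ne' (tendsto_nhds_unique hlim hlim0)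

lemma apply_ofReal_eq_re_of_taylorAtZero_eq_map {f : ℂ → ℂ} {p : PowerSeries ℝ} (hf : Differentiable ℂ f)
    (hp : taylorAtZero f = PowerSeries.map Complex.ofRealHom p) (x : ℝ) :
    f x = ((f x).re : ℂ) := by
  have hz : (x : ℂ) ∈ Metric.ball (0 : ℂ) (‖(x : ℂ)‖ + 1) := by simp
  have h1 := hasSum_taylorAtZero hf.differentiableOn hz
  have h2 := Complex.hasSum_im h1
  have h3 : (fun n => (PowerSeries.coeff n (taylorAtZero f) * (x : ℂ) ^ n).im) = fun _ => 0 := by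
    ext n
    rw [hp, PowerSeries.coeff_map, Complex.ofRealHom_eq_coe, ← Complex.ofReal_pow,
      ← Complex.ofReal_mul, Complex.ofReal_im]
  rw [h3] at h2
  have h4 := h2.unique hasSum_zero
  apply Complex.ext <;> simp [h4]

section Coulomb

variable {L η : ℝ}

lemma hasDerivAt_comp_ofReal_mul {f : ℂ → ℂ} (hf : Differentiable ℂ f) (w : ℂ) (t : ℝ) :
    HasDerivAt (fun s : ℝ => f (s * w)) (w * deriv f (t * w)) t := by
  have h2 : HasDerivAt (fun s : ℂ => s * w) w (t : ℂ) := by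
    simpa using (hasDerivAt_id (t : ℂ)).mul_const w
  rw [mul_comm]
  exact (HasDerivAt.comp (t : ℂ) (hf _).hasDerivAt h2).comp_ofReal

/-- The logarithmic derivative of `φ` maps the upper half-plane to the lower one and conversely. -/
lemma im_mul_im_deriv_coulombPhi_neg (hL : -1 < L) {w : ℂ} (hw : w.im ≠ 0) :
    w.im * (deriv (coulombPhi L η) w * star (coulombPhi L η w)).im < 0 := by
  have hφ := differentiable_coulombPhi hL η
  have hφ' := differentiable_deriv_coulombPhi (η := η) hL
  -- The power of `t` is the integrating factor for the term `(2L+2)φ'`: by the differential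
  -- equation `E' = -t^(2L+2) g`. It also makes `E 0 = 0`, as `2L+2 > 0`.
  set E : ℝ → ℝ := fun t => t ^ (2 * L + 2) *
    (w.im * (deriv (coulombPhi L η) (t * w) * star (coulombPhi L η (t * w))).im) with hE
  set g : ℝ → ℝ := fun t => w.im ^ 2 * (Complex.normSq (coulombPhi L η (t * w)) +
    Complex.normSq (deriv (coulombPhi L η) (t * w))) with hg
  have hφc := hφ.continuous
  have hφc' := hφ'.continuous
  have hE1 : E 1 < 0 := by
    refine neg_of_hasDerivAt_neg_rpow_mul (g := g) (a := 2 * L + 2) ?_ ?_ ?_ ?_ ?_ ?_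
    · refine Continuous.continuousOn ((Real.continuous_rpow_const (by linarith)).mul ?_)
      exact continuous_const.mul (Complex.continuous_im.comp (by fun_prop))
    · simp [hE, Real.zero_rpow (show 2 * L + 2 ≠ 0 by linarith)]
    · exact continuous_const.mul ((Complex.continuous_normSq.comp (by fun_prop)).add
        (Complex.continuous_normSq.comp (by fun_prop)))
    · have : 0 < w.im ^ 2 := by positivity
      simp only [hg, Complex.ofReal_zero, zero_mul, coulombPhi_zero, map_one]
      exact mul_pos this (by linarith [Complex.normSq_nonneg (deriv (coulombPhi L η) 0)])
    · exact fun t => mul_nonneg (sq_nonneg _)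
        (add_nonneg (Complex.normSq_nonneg _) (Complex.normSq_nonneg _))
    · intro t ht
      have d0 := hasDerivAt_comp_ofReal_mul hφ w t
      have d1 := hasDerivAt_comp_ofReal_mul hφ' w t
      have d2 := d1.mul d0.star
      have d3 : HasDerivAt (fun s : ℝ => (deriv (coulombPhi L η) (s * w) *
          star (coulombPhi L η (s * w))).im) _ t :=
        (Complex.imCLM.hasFDerivAt.comp_hasDerivAt t d2)
      have d4 := Real.hasDerivAt_rpow_const (p := 2 * L + 2) (Or.inl ht.1.ne')
      refine (d4.mul (d3.const_mul w.im)).congr_deriv ?_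
      have hode := coulombPhi_ode (η := η) hL (t * w)
      have hpow : t ^ (2 * L + 2) = t * t ^ (2 * L + 2 - 1) := by
        rw [Real.rpow_sub_one ht.1.ne']
        field_simp [ht.1.ne']
      rw [hpow]
      have hre := congrArg Complex.re hode
      have him := congrArg Complex.im hode
      simp only [hg, Complex.imCLM_apply, Complex.normSq_apply, Complex.add_im, Complex.add_re,
        Complex.mul_im, Complex.mul_re, Complex.sub_re, Complex.sub_im, Complex.star_def,
        Complex.conj_re, Complex.conj_im, Complex.ofReal_re, Complex.ofReal_im, map_mul,
        Complex.zero_re, Complex.zero_im, Complex.re_ofNat, Complex.im_ofNat] at hre him ⊢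
      generalize deriv (deriv (coulombPhi L η)) (t * w) = c at *
      generalize deriv (coulombPhi L η) (t * w) = b at *
      generalize coulombPhi L η (t * w) = a at *
      generalize t ^ (2 * L + 2 - 1) = T at *
      linear_combination (T * w.im * a.re) * him - (T * w.im * a.im) * hre
  simpa [hE] using hE1

/-- At a zero `wφ' = -(L+1)φ`, so `φ' φ̄` is a nonpositive multiple of `w̄`. Its imaginary part
times `Im w` is then nonnegative, which contradicts the sign of `Im(φ'/φ)` off the real axis. -/
lemma im_eq_zero_of_coulombG_eq_zero (hL : -1 < L) {w : ℂ} (hw : coulombG L η w = 0) :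
    w.im = 0 := by
  by_contra him
  have h := im_mul_im_deriv_coulombPhi_neg (η := η) hL him
  have hw0 : w ≠ 0 := by
    rintro rfl
    simp at him
  have h1 : deriv (coulombPhi L η) w * star (coulombPhi L η w) =
      ((-(L + 1) * Complex.normSq (coulombPhi L η w) / Complex.normSq w : ℝ) : ℂ) * star w := by
    have hs : star w ≠ 0 := by simpa using hw0
    unfold coulombG at hw
    push_cast
    simp only [Complex.normSq_eq_conj_mul_self, ← Complex.star_def]
    field_simp
    linear_combination star (coulombPhi L η w) * hw
  rw [h1, Complex.im_ofReal_mul, Complex.star_def, Complex.conj_im] at h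
  have h2 : 0 ≤ (L + 1) * Complex.normSq (coulombPhi L η w) / Complex.normSq w :=
    div_nonneg (mul_nonneg (by linarith) (Complex.normSq_nonneg _)) (Complex.normSq_nonneg _)
  have h3 : w.im * (-(L + 1) * Complex.normSq (coulombPhi L η w) / Complex.normSq w * -w.im) =
      w.im ^ 2 * ((L + 1) * Complex.normSq (coulombPhi L η w) / Complex.normSq w) := by ring
  rw [h3] at h
  exact absurd (mul_nonneg (sq_nonneg w.im) h2) (not_le.2 h)

lemma coulombPhi_ofReal (hL : -1 < L) (x : ℝ) :
    coulombPhi L η x = ((coulombPhi L η x).re : ℂ) :=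
  apply_ofReal_eq_re_of_taylorAtZero_eq_map (differentiable_coulombPhi hL η) (taylorAtZero_coulombPhi hL) x

lemma deriv_coulombPhi_ofReal (hL : -1 < L) (x : ℝ) :
    deriv (coulombPhi L η) x = ((deriv (coulombPhi L η) x).re : ℂ) :=
  apply_ofReal_eq_re_of_taylorAtZero_eq_map (p := PowerSeries.derivative ℝ (coulombSeries L η))
    (differentiable_deriv_coulombPhi hL)
    (by rw [taylorAtZero_deriv, taylorAtZero_coulombPhi hL, map_derivative]) x

/-- A strict Laguerre inequality for `φ`, rewritten by means of the differential equation. -/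
lemma coulombPhi_laguerre (hL : -1 < L) {x : ℝ} (hx : x ≠ 0) :
    0 < x * (x * (deriv (coulombPhi L η) x).re ^ 2
      + (2 * L + 2) * (coulombPhi L η x).re * (deriv (coulombPhi L η) x).re
      + (x - 2 * η) * (coulombPhi L η x).re ^ 2) := by
  have hφ := differentiable_coulombPhi hL η
  have hφ' := differentiable_deriv_coulombPhi (η := η) hL
  have hφc := hφ.continuous
  have hφc' := hφ'.continuous
  set u : ℝ → ℝ := fun t => (coulombPhi L η (t * x)).re with hu
  set v : ℝ → ℝ := fun t => (deriv (coulombPhi L η) (t * x)).re with hv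
  have huc : Continuous u := Complex.continuous_re.comp (by fun_prop)
  have hvc : Continuous v := Complex.continuous_re.comp (by fun_prop)
  -- By the differential equation the bracket is `tx(φ'² - φφ'')` at `tx`. With the same integrating
  -- factor, `E' = -t^(2L+2) x² (φ² + φ'²)`.
  set E : ℝ → ℝ := fun t => t ^ (2 * L + 2) * (-x * (t * x * v t ^ 2
      + (2 * L + 2) * u t * v t + (t * x - 2 * η) * u t ^ 2)) with hE
  have hE1 : E 1 < 0 := by
    refine neg_of_hasDerivAt_neg_rpow_mul (g := fun t => x ^ 2 * (u t ^ 2 + v t ^ 2))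
      (a := 2 * L + 2) ?_ ?_ ?_ ?_ ?_ ?_
    · exact Continuous.continuousOn ((Real.continuous_rpow_const (by linarith)).mul (by fun_prop))
    · simp [hE, Real.zero_rpow (show 2 * L + 2 ≠ 0 by linarith)]
    · fun_prop
    · have : 0 < x ^ 2 := by positivity
      simp only [hu, hv, Complex.ofReal_zero, zero_mul, coulombPhi_zero, Complex.one_re]
      positivity
    · intro t
      positivity
    · intro t ht
      have d0 : HasDerivAt u (x * v t) t := by
        have := Complex.reCLM.hasFDerivAt.comp_hasDerivAt t (hasDerivAt_comp_ofReal_mul hφ x t)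
        simpa [hv] using! this
      have d1 : HasDerivAt v (x * (deriv (deriv (coulombPhi L η)) (t * x)).re) t := by
        have := Complex.reCLM.hasFDerivAt.comp_hasDerivAt t (hasDerivAt_comp_ofReal_mul hφ' x t)
        simpa using! this
      have d4 := Real.hasDerivAt_rpow_const (p := 2 * L + 2) (Or.inl ht.1.ne')
      have dt : HasDerivAt (fun s : ℝ => s * x) x t := by
        simpa using (hasDerivAt_id t).mul_const x
      refine (d4.mul ((((dt.mul (d1.pow 2)).add ((d0.const_mul (2 * L + 2)).mul d1)).add
        ((dt.sub_const (2 * η)).mul (d0.pow 2))).const_mul (-x))).congr_deriv ?_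
      have hode := congrArg Complex.re (coulombPhi_ode (η := η) hL (t * x))
      have hpow : t ^ (2 * L + 2) = t * t ^ (2 * L + 2 - 1) := by
        rw [Real.rpow_sub_one ht.1.ne']
        field_simp [ht.1.ne']
      rw [hpow]
      simp only [Complex.add_re, Complex.mul_re, Complex.mul_im, Complex.sub_re, Complex.sub_im,
        Complex.add_im, Complex.ofReal_re, Complex.ofReal_im, Complex.zero_re, Complex.re_ofNat,
        Complex.im_ofNat] at hode
      simp only [Pi.pow_apply, Pi.add_apply, Pi.mul_apply, hu, hv]
      generalize (deriv (deriv (coulombPhi L η)) (t * x)).re = c at *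
      generalize (deriv (coulombPhi L η) (t * x)).re = b at *
      generalize (coulombPhi L η (t * x)).re = a at *
      generalize t ^ (2 * L + 2 - 1) = T at *
      push_cast
      linear_combination (-T * x * (2 * t * x * b + (2 * L + 2) * a)) * hode
  simp only [hE, hu, hv, Real.one_rpow, Complex.ofReal_one, one_mul] at hE1
  linarith

/-- At a double zero, `G = G' = 0` would turn the positive Laguerre expression into `-(L+1)φ² ≤ 0`.
-/
lemma deriv_coulombG_ne_zero (hL : -1 < L) {w : ℂ} (hw : coulombG L η w = 0) :
    deriv (coulombG L η) w ≠ 0 := by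
  intro hd
  have him := im_eq_zero_of_coulombG_eq_zero hL hw
  obtain ⟨x, rfl⟩ : ∃ x : ℝ, w = x := ⟨w.re, Complex.ext (by simp) (by simp [him])⟩
  have hx : x ≠ 0 := by
    rintro rfl
    rw [Complex.ofReal_zero, coulombG_zero] at hw
    have : L + 1 = 0 := by exact_mod_cast hw
    linarith
  have hlag := coulombPhi_laguerre (η := η) hL hx
  rw [deriv_coulombG hL] at hd
  unfold coulombG at hw
  rw [coulombPhi_ofReal hL, deriv_coulombPhi_ofReal hL] at hd hw
  generalize (deriv (coulombPhi L η) x).re = b at *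
  generalize (coulombPhi L η x).re = a at *
  have h1 : (L + 1) * a + x * b = 0 := by exact_mod_cast hw
  have h2 : -L * b - (x - 2 * η) * a = 0 := by exact_mod_cast hd
  have h3 : x * (x * b ^ 2 + (2 * L + 2) * a * b + (x - 2 * η) * a ^ 2) =
      -((L + 1) * a ^ 2) := by
    linear_combination (x * b + a) * h1 - x * a * h2
  rw [h3] at hlag
  have : 0 ≤ (L + 1) * a ^ 2 := mul_nonneg (by linarith) (sq_nonneg a)
  linarith

/-- If `φ` vanished too, then `φ'` and hence `G'` would vanish, against simplicity. -/
lemma coulombPhi_ne_zero_of_coulombG_eq_zero (hL : -1 < L) {w : ℂ} (hw : coulombG L η w = 0) :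
    coulombPhi L η w ≠ 0 := by
  intro h0
  have hd := deriv_coulombG_ne_zero hL hw
  have hw0 : w ≠ 0 := by
    rintro rfl
    simp [coulombPhi_zero] at h0
  rw [coulombG, h0, mul_zero, zero_add, mul_eq_zero, or_iff_right hw0] at hw
  rw [deriv_coulombG hL, h0, hw] at hd
  simp at hd

end Coulomb

/-! ### Reciprocal power sums of the zeros of an entire function of exponential type -/

lemma taylorAtZero_sum {ι : Type*} (s : Finset ι) {f : ι → ℂ → ℂ}
    (hf : ∀ i ∈ s, AnalyticAt ℂ (f i) 0) :
    taylorAtZero (fun z => ∑ i ∈ s, f i z) = ∑ i ∈ s, taylorAtZero (f i) := by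
  classical
  induction s using Finset.induction_on with
  | empty => simpa using taylorAtZero_const 0
  | insert a s ha ih =>
    have h1 : ∀ i ∈ s, AnalyticAt ℂ (f i) 0 := fun i hi => hf i (Finset.mem_insert_of_mem hi)
    simp only [Finset.sum_insert ha]
    rw [taylorAtZero_add (hf a (Finset.mem_insert_self _ _)) (Finset.analyticAt_fun_sum s h1),
      ih h1]

lemma taylorAtZero_inv_sub {a : ℂ} (ha : a ≠ 0) :
    taylorAtZero (fun z => (a - z)⁻¹) = PowerSeries.mk fun n => 1 / a ^ (n + 1) := by
  apply taylorAtZero_of_hasSum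
  have hpos : 0 < ‖a‖ := norm_pos_iff.2 ha
  filter_upwards [Metric.ball_mem_nhds (0 : ℂ) hpos] with z hz
  rw [Metric.mem_ball, dist_zero_right] at hz
  have h1 : ‖z / a‖ < 1 := by rwa [norm_div, div_lt_one hpos]
  have h2 := (hasSum_geometric_of_norm_lt_one h1).mul_left a⁻¹
  have h3 : a⁻¹ * (1 - z / a)⁻¹ = (a - z)⁻¹ := by
    rw [← mul_inv]
    congr 1
    field_simp
  rw [h3] at h2
  refine h2.congr_fun fun n => ?_
  rw [div_pow, pow_succ]
  field_simp

lemma finite_zeros_of_entire {G : ℂ → ℂ} (hG : Differentiable ℂ G) (h0 : G 0 ≠ 0) (R : ℝ) :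
    {z | G z = 0 ∧ ‖z‖ < R}.Finite := by
  by_contra hinf
  obtain ⟨w, -, hw⟩ := Set.Infinite.exists_accPt_of_subset_isCompact hinf
    (isCompact_closedBall (0 : ℂ) R) (fun z hz => by simpa using hz.2.le)
  rw [accPt_iff_frequently_nhdsNE] at hw
  have h1 : ∃ᶠ z in 𝓝[≠] w, G z = (fun _ => (0 : ℂ)) z := hw.mono fun z hz => hz.1
  have h2 := AnalyticOnNhd.eq_of_frequently_eq (fun z _ => hG.analyticAt z)
    (fun z _ => analyticAt_const) h1
  exact h0 (congrFun h2 0)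

lemma exists_entire_factorization {G : ℂ → ℂ} (hG : Differentiable ℂ G) (S : Finset ℂ)
    (hS : ∀ a ∈ S, a ≠ 0 ∧ G a = 0) :
    ∃ g : ℂ → ℂ, Differentiable ℂ g ∧ ∀ z, G z = (∏ a ∈ S, (1 - z / a)) * g z := by
  classical
  induction S using Finset.induction_on with
  | empty => exact ⟨G, hG, by simp⟩
  | insert a S ha ih =>
    obtain ⟨g, hg, hgG⟩ := ih fun b hb => hS b (Finset.mem_insert_of_mem hb)
    obtain ⟨ha0, haG⟩ := hS a (Finset.mem_insert_self _ _)
    have hga : g a = 0 := by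
      rw [hgG a, mul_eq_zero, Finset.prod_eq_zero_iff] at haG
      refine haG.resolve_left ?_
      rintro ⟨b, hb, hab⟩
      have hb0 := (hS b (Finset.mem_insert_of_mem hb)).1
      rw [sub_eq_zero, eq_comm, div_eq_one_iff_eq hb0] at hab
      exact ha (hab ▸ hb)
    -- The factor comes from `z - a = -a (1 - z/a)`.
    refine ⟨fun z => -a * dslope g a z, ?_, fun z => ?_⟩
    · rw [← differentiableOn_univ] at hg ⊢
      exact ((Complex.differentiableOn_dslope univ_mem).2 hg).const_mul _
    · have h1 := sub_smul_dslope g a z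
      rw [hga, sub_zero, smul_eq_mul] at h1
      rw [Finset.prod_insert ha, hgG z, ← h1]
      field_simp
      ring

lemma exists_log_of_ne_zero {g : ℂ → ℂ} {R : ℝ} (hR : 0 < R)
    (hg : DifferentiableOn ℂ g (Metric.ball 0 R)) (hne : ∀ z ∈ Metric.ball (0 : ℂ) R, g z ≠ 0) :
    ∃ h : ℂ → ℂ, DifferentiableOn ℂ h (Metric.ball 0 R) ∧ h 0 = 0 ∧
      ∀ z ∈ Metric.ball (0 : ℂ) R, g z = g 0 * Complex.exp (h z) := by
  have hq : DifferentiableOn ℂ (fun z => deriv g z / g z) (Metric.ball 0 R) :=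
    (hg.deriv Metric.isOpen_ball).div hg hne
  obtain ⟨h, hh⟩ := hq.isExactOn_ball
  have h0 : (0 : ℂ) ∈ Metric.ball (0 : ℂ) R := by simpa using hR
  refine ⟨fun z => h z - h 0, fun z hz => ((hh z hz).sub_const _).differentiableAt.differentiableWithinAt,
    sub_self _, fun z hz => ?_⟩
  have hconst : ∀ w ∈ Metric.ball (0 : ℂ) R,
      HasDerivWithinAt (fun w => g w * Complex.exp (-(h w - h 0))) 0 (Metric.ball (0 : ℂ) R) w := by
    intro w hw
    have hgw := (hg.differentiableAt (Metric.isOpen_ball.mem_nhds hw)).hasDerivAt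
    have h1 := hgw.mul (((hh w hw).sub_const (h 0)).neg.cexp)
    refine (h1.congr_deriv ?_).hasDerivWithinAt
    have := hne w hw
    field_simp
    ring
  have hc := (convex_ball (0 : ℂ) R).norm_image_sub_le_of_norm_hasDerivWithin_le (C := 0)
    hconst (by simp) h0 hz
  rw [zero_mul] at hc
  have hc' := sub_eq_zero.1 (norm_le_zero_iff.1 hc)
  simp only [sub_self, neg_zero, Complex.exp_zero, mul_one] at hc'
  rw [← hc', mul_assoc, ← Complex.exp_add]
  simp

/-- Borel–Carathéodory bounds `|h|` by `2M|z|/(R-|z|)`, which is `2M` on `|z| = R/2`; Cauchy's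
estimate on that circle does the rest. -/
lemma norm_coeff_taylorAtZero_le_of_re_le {h : ℂ → ℂ} {R M : ℝ} (hR : 0 < R) (hM : 0 < M)
    (hd : DifferentiableOn ℂ h (Metric.ball 0 R)) (h0 : h 0 = 0)
    (hre : ∀ z ∈ Metric.ball (0 : ℂ) R, (h z).re ≤ M) (n : ℕ) :
    ‖PowerSeries.coeff n (taylorAtZero h)‖ ≤ 2 * M / (R / 2) ^ n := by
  have hR2 : 0 < R / 2 := by positivity
  have hcl : Metric.closedBall (0 : ℂ) (R / 2) ⊆ Metric.ball 0 R :=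
    Metric.closedBall_subset_ball (by linarith)
  have h1 := Complex.norm_iteratedDeriv_le_of_forall_mem_sphere_norm_le (C := 2 * M) n hR2
    (hd.diffContOnCl_ball hcl) (fun z hz => by
      have hz' : ‖z‖ = R / 2 := by simpa using hz
      have h2 := Complex.borelCaratheodory_zero hM hd (fun z hz => hre z hz) hR
        (hcl (Metric.sphere_subset_closedBall hz)) h0
      rw [hz'] at h2
      refine h2.trans (le_of_eq ?_)
      field_simp
      ring)
  have hn : (0 : ℝ) < n.factorial := by exact_mod_cast n.factorial_pos
  rw [coeff_taylorAtZero, norm_div, Complex.norm_natCast, div_le_iff₀ hn]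
  refine h1.trans (le_of_eq ?_)
  ring

/-- For an entire function of exponential type with simple zeros, the power sums of the reciprocals
of the zeros in a disk differ little from the coefficients of `-G' / G`. -/
lemma norm_sum_inv_zeros_sub_coeff_le {G : ℂ → ℂ} (hG : Differentiable ℂ G) (hG0 : G 0 ≠ 0)
    {A K : ℝ} (hA : 0 < A) (hK : 0 ≤ K) (hbd : ∀ z, ‖G z‖ ≤ ‖G 0‖ * Real.exp (A + K * ‖z‖))
    (hsimple : ∀ z, G z = 0 → deriv G z ≠ 0) {Y : PowerSeries ℂ}
    (hY : taylorAtZero (deriv G) = -Y * taylorAtZero G) {R : ℝ} (hR : 0 < R) (k : ℕ) :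
    ‖∑ a ∈ (finite_zeros_of_entire hG hG0 R).toFinset, 1 / a ^ (k + 1) - PowerSeries.coeff k Y‖ ≤
      2 * (A + K * (2 * R)) / (R / 2) ^ (k + 1) * (k + 1) := by
  set S := (finite_zeros_of_entire hG hG0 R).toFinset with hSdef
  have hS : ∀ a ∈ S, a ≠ 0 ∧ G a = 0 := by
    intro a ha
    have h1 : G a = 0 ∧ ‖a‖ < R := by simpa [hSdef] using ha
    refine ⟨?_, h1.1⟩
    rintro rfl
    exact hG0 h1.1
  obtain ⟨g, hg, hgG⟩ := exists_entire_factorization hG S hS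
  have hg0 : g 0 = G 0 := by rw [hgG 0]; simp
  have hprod : Differentiable ℂ fun z : ℂ => ∏ a ∈ S, (1 - z / a) := by fun_prop
  -- Each zero was divided out once; a zero left in `g` would be a multiple zero of `G`.
  have hne : ∀ z ∈ Metric.ball (0 : ℂ) R, g z ≠ 0 := by
    intro z hz hgz
    have hGz : G z = 0 := by rw [hgG z, hgz, mul_zero]
    have hzS : z ∈ S := by
      have : ‖z‖ < R := by simpa using hz
      simpa [hSdef] using ⟨hGz, this⟩
    apply hsimple z hGz
    have h1 : HasDerivAt G _ z :=
      ((hprod z).hasDerivAt.mul (hg z).hasDerivAt).congr_of_eventuallyEq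
        (Eventually.of_forall hgG)
    rw [h1.deriv, hgz, Finset.prod_eq_zero hzS (by rw [div_self (hS z hzS).1, sub_self])]
    simp
  obtain ⟨h, hhd, hh0, hexp⟩ := exists_log_of_ne_zero hR hg.differentiableOn hne
  -- The maximum principle is applied on radius `2R`, where `|w/a| ≥ 2` makes every factor `1 - w/a`
  -- at least `1` in modulus, so that `|g| ≤ |G|` there.
  have hgbd : ∀ z ∈ Metric.ball (0 : ℂ) R, ‖g z‖ ≤ ‖G 0‖ * Real.exp (A + K * (2 * R)) := by
    intro z hz
    refine Complex.norm_le_of_forall_mem_frontier_norm_le (U := Metric.ball 0 (2 * R))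
      Metric.isBounded_ball hg.diffContOnCl (fun w hw => ?_)
      (subset_closure (Metric.ball_subset_ball (by linarith) hz))
    rw [frontier_ball _ (by positivity)] at hw
    have hw' : ‖w‖ = 2 * R := by simpa using hw
    have h1 : 1 ≤ ‖∏ a ∈ S, (1 - w / a)‖ := by
      rw [norm_prod]
      refine Finset.one_le_prod fun a ha => ?_
      have h2 : ‖a‖ < R := by
        have : G a = 0 ∧ ‖a‖ < R := by simpa [hSdef] using ha
        exact this.2
      have h3 : 0 < ‖a‖ := norm_pos_iff.2 (hS a ha).1
      have h4 : 2 ≤ ‖w / a‖ := by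
        rw [norm_div, hw', le_div_iff₀ h3]
        linarith
      have h5 := norm_sub_norm_le (w / a) 1
      rw [norm_one, norm_sub_rev] at h5
      linarith
    have h2 := hbd w
    rw [hgG w, norm_mul, hw'] at h2
    exact (le_mul_of_one_le_left (norm_nonneg _) h1).trans h2
  have hre : ∀ z ∈ Metric.ball (0 : ℂ) R, (h z).re ≤ A + K * (2 * R) := by
    intro z hz
    have h1 := hgbd z hz
    rw [hexp z hz, norm_mul, hg0, Complex.norm_exp] at h1
    exact Real.exp_le_exp.1 (le_of_mul_le_mul_left h1 (norm_pos_iff.2 hG0))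
  have hcoeff := norm_coeff_taylorAtZero_le_of_re_le hR (by positivity) hhd hh0 hre (k + 1)
  have hnhds : Metric.ball (0 : ℂ) R ∈ 𝓝 0 := Metric.ball_mem_nhds _ hR
  have hha : AnalyticAt ℂ h 0 := hhd.analyticAt hnhds
  -- The logarithmic derivative of `G = ∏ (1 - z/a) · g(0) e^h`. Its coefficient of order `k` is
  -- minus the finite power sum plus `(k+1)h_{k+1}`, so the error is governed by `h` alone.
  have hlog : deriv G =ᶠ[𝓝 0] fun z => G z * ((∑ a ∈ S, -1 * (a - z)⁻¹) + deriv h z) := by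
    filter_upwards [hnhds, hG.continuous.continuousAt.eventually_ne hG0] with z hz hGz
    have hP : ∏ a ∈ S, (1 - z / a) ≠ 0 := by
      intro hP
      rw [hgG z, hP, zero_mul] at hGz
      exact hGz rfl
    have hP' := Finset.prod_ne_zero_iff.1 hP
    have e1 : logDeriv G z = logDeriv (fun z => ∏ a ∈ S, (1 - z / a)) z + logDeriv g z := by
      rw [show G = fun z => (∏ a ∈ S, (1 - z / a)) * g z from funext hgG]
      exact logDeriv_mul z hP (hne z hz) (hprod z) (hg z)
    have e2 : logDeriv (fun z => ∏ a ∈ S, (1 - z / a)) z = ∑ a ∈ S, -1 * (a - z)⁻¹ := by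
      rw [logDeriv_prod hP' (fun a _ => by fun_prop)]
      refine Finset.sum_congr rfl fun a ha => ?_
      have ha0 := (hS a ha).1
      have hd : HasDerivAt (fun z : ℂ => 1 - z / a) (-(1 / a)) z :=
        ((hasDerivAt_id z).div_const a).const_sub 1
      rw [logDeriv_apply, hd.deriv]
      have h3 := hP' a ha
      have h4 : a - z ≠ 0 := by
        intro h4
        apply h3
        rw [← sub_eq_zero.1 h4, div_self ha0, sub_self]
      field_simp
    have e3 : logDeriv g z = deriv h z := by
      have hhz := (hhd.differentiableAt (Metric.isOpen_ball.mem_nhds hz)).hasDerivAt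
      have hgz : HasDerivAt g (g 0 * (Complex.exp (h z) * deriv h z)) z := by
        refine (hhz.cexp.const_mul (g 0)).congr_of_eventuallyEq ?_
        filter_upwards [Metric.isOpen_ball.mem_nhds hz] with w hw using hexp w hw
      rw [logDeriv_apply, hgz.deriv, ← mul_assoc, ← hexp z hz]
      exact mul_div_cancel_left₀ _ (hne z hz)
    rw [← e2, ← e3, ← e1, logDeriv_apply, mul_div_cancel₀ _ hGz]
  have hanS : ∀ a ∈ S, AnalyticAt ℂ (fun z => -1 * (a - z)⁻¹) 0 := fun a ha =>
    analyticAt_const.mul ((analyticAt_const.sub analyticAt_id).inv (by simpa using (hS a ha).1))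
  have hT := taylorAtZero_congr hlog
  rw [taylorAtZero_mul (hG.analyticAt 0) ((Finset.analyticAt_fun_sum S hanS).fun_add hha.deriv),
    taylorAtZero_add (Finset.analyticAt_fun_sum S hanS) hha.deriv, taylorAtZero_sum S hanS,
    taylorAtZero_deriv h, hY, mul_comm] at hT
  have hGne : taylorAtZero G ≠ 0 := by
    intro h0
    have := congrArg (PowerSeries.coeff 0) h0
    rw [coeff_taylorAtZero] at this
    simp [hG0] at this
  have hT2 := congrArg (PowerSeries.coeff k) (mul_left_cancel₀ hGne hT)
  have hT3 : ∀ a ∈ S, PowerSeries.coeff k (taylorAtZero fun z => -1 * (a - z)⁻¹) =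
      -(1 / a ^ (k + 1)) := by
    intro a ha
    have ha0 := (hS a ha).1
    have han : AnalyticAt ℂ (fun z => (a - z)⁻¹) 0 :=
      (analyticAt_const.sub analyticAt_id).inv (by simpa using ha0)
    rw [taylorAtZero_mul analyticAt_const han, taylorAtZero_const, taylorAtZero_inv_sub ha0,
      PowerSeries.coeff_C_mul, PowerSeries.coeff_mk, neg_one_mul]
  rw [map_neg, map_add, map_sum, Finset.sum_congr rfl hT3, Finset.sum_neg_distrib,
    PowerSeries.coeff_derivative] at hT2
  have hfin : ∑ a ∈ S, 1 / a ^ (k + 1) - PowerSeries.coeff k Y =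
      PowerSeries.coeff (k + 1) (taylorAtZero h) * ((k : ℂ) + 1) := by
    linear_combination hT2
  rw [hfin, norm_mul]
  have hk : ‖(k : ℂ) + 1‖ = (k : ℝ) + 1 := by
    rw [← Nat.cast_succ, Complex.norm_natCast, Nat.cast_succ]
  rw [hk]
  gcongr

/-- The error bound is of order `R^(-k)`, which tends to `0` only for `k ≥ 1`; this is why power
sums start at exponent `2`. -/
lemma tendsto_sum_inv_zeros {G : ℂ → ℂ} (hG : Differentiable ℂ G) (hG0 : G 0 ≠ 0)
    {A K : ℝ} (hA : 0 < A) (hK : 0 ≤ K) (hbd : ∀ z, ‖G z‖ ≤ ‖G 0‖ * Real.exp (A + K * ‖z‖))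
    (hsimple : ∀ z, G z = 0 → deriv G z ≠ 0) {Y : PowerSeries ℂ}
    (hY : taylorAtZero (deriv G) = -Y * taylorAtZero G) {k : ℕ} (hk : 1 ≤ k) :
    Tendsto (fun R : ℕ => ∑ a ∈ (finite_zeros_of_entire hG hG0 R).toFinset, 1 / a ^ (k + 1)) atTop
      (𝓝 (PowerSeries.coeff k Y)) := by
  rw [tendsto_iff_norm_sub_tendsto_zero]
  have hlim : Tendsto (fun R : ℕ => 2 ^ (k + 2) * (k + 1) * (A + 2 * K) * (1 / (R : ℝ))) atTop
      (𝓝 0) := by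
    simpa using tendsto_one_div_atTop_nhds_zero_nat.const_mul
      ((2 : ℝ) ^ (k + 2) * (k + 1) * (A + 2 * K))
  refine squeeze_zero' (Eventually.of_forall fun R => norm_nonneg _) ?_ hlim
  filter_upwards [eventually_ge_atTop 1] with R hR
  have hR1 : (1 : ℝ) ≤ R := by exact_mod_cast hR
  have hR0 : (0 : ℝ) < R := by linarith
  refine (norm_sum_inv_zeros_sub_coeff_le hG hG0 hA hK hbd hsimple hY hR0 k).trans ?_
  have h1 : (R : ℝ) ^ 2 ≤ R ^ (k + 1) := pow_le_pow_right₀ hR1 (by omega)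
  have h2 : A + K * (2 * R) ≤ (A + 2 * K) * R := by nlinarith
  calc 2 * (A + K * (2 * R)) / (R / 2) ^ (k + 1) * (k + 1)
      = 2 ^ (k + 2) * (k + 1) * (A + K * (2 * R)) / R ^ (k + 1) := by
        rw [div_pow, pow_succ 2 (k + 1)]
        field_simp
    _ ≤ 2 ^ (k + 2) * (k + 1) * ((A + 2 * K) * R) / R ^ 2 := by gcongr
    _ = _ := by field_simp

/-- For real zeros the terms with exponent `2` are positive, so convergence along growing disks is
already absolute. The zeros stay away from `0`, so higher exponents are dominated, and the limit
over disks identifies the sum. -/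
lemma hasSum_inv_zeros {G : ℂ → ℂ} (hG : Differentiable ℂ G) (hG0 : G 0 ≠ 0)
    {A K : ℝ} (hA : 0 < A) (hK : 0 ≤ K) (hbd : ∀ z, ‖G z‖ ≤ ‖G 0‖ * Real.exp (A + K * ‖z‖))
    (hsimple : ∀ z, G z = 0 → deriv G z ≠ 0) (hreal : ∀ z, G z = 0 → z.im = 0)
    {Y : PowerSeries ℂ}
    (hY : taylorAtZero (deriv G) = -Y * taylorAtZero G) {k : ℕ} (hk : 1 ≤ k) :
    HasSum (fun a : {z | G z = 0} => 1 / (a : ℂ) ^ (k + 1)) (PowerSeries.coeff k Y) := by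
  classical
  set F : ℕ → Finset {z | G z = 0} := fun R =>
    (finite_zeros_of_entire hG hG0 R).toFinset.subtype (· ∈ {z | G z = 0}) with hF
  have hmem : ∀ (R : ℕ) (a : {z | G z = 0}), a ∈ F R ↔ ‖(a : ℂ)‖ < R := by
    intro R a
    have : G (a : ℂ) = 0 := a.2
    simp [hF, this]
  have hFtop : Tendsto F atTop atTop := by
    refine tendsto_atTop_finset_of_monotone ?_ fun a => ?_
    · intro R R' hRR' a ha
      rw [hmem] at ha ⊢
      exact ha.trans_le (by exact_mod_cast hRR')
    · obtain ⟨R, hR⟩ := exists_nat_gt ‖(a : ℂ)‖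
      exact ⟨R, (hmem R a).2 hR⟩
  have hsum : ∀ (R j : ℕ), ∑ a ∈ F R, 1 / (a : ℂ) ^ j =
      ∑ a ∈ (finite_zeros_of_entire hG hG0 R).toFinset, 1 / a ^ j := by
    intro R j
    refine Finset.sum_subtype_of_mem (fun a : ℂ => 1 / a ^ j) (p := (· ∈ {z | G z = 0})) ?_
    intro a ha
    have : G a = 0 ∧ ‖a‖ < R := by simpa using ha
    exact this.1
  have hlim : ∀ j : ℕ, 1 ≤ j → Tendsto (fun R => ∑ a ∈ F R, 1 / (a : ℂ) ^ (j + 1)) atTop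
      (𝓝 (PowerSeries.coeff j Y)) := by
    intro j hj
    simp only [hsum]
    exact tendsto_sum_inv_zeros hG hG0 hA hK hbd hsimple hY hj
  have hsq : ∀ a : {z | G z = 0}, 1 / (a : ℂ) ^ 2 = ((1 / ‖(a : ℂ)‖ ^ 2 : ℝ) : ℂ) := by
    intro a
    have him := hreal a a.2
    have h1 : (a : ℂ) = ((a : ℂ).re : ℂ) := Complex.ext (by simp) (by simp [him])
    rw [h1, Complex.norm_real, Real.norm_eq_abs, sq_abs]
    push_cast
    rfl
  have hsq_nonneg : ∀ a : {z | G z = 0}, 0 ≤ 1 / ‖(a : ℂ)‖ ^ 2 := fun a => by positivity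
  have hsummable2 : Summable fun a : {z | G z = 0} => 1 / ‖(a : ℂ)‖ ^ 2 := by
    refine summable_of_sum_le (c := ‖PowerSeries.coeff 1 Y‖) hsq_nonneg fun u => ?_
    refine ge_of_tendsto (hlim 1 le_rfl).norm ?_
    filter_upwards [hFtop.eventually_ge_atTop u] with R hR
    rw [Finset.sum_congr rfl fun a _ => hsq a, ← Complex.ofReal_sum, Complex.norm_real,
      Real.norm_of_nonneg (Finset.sum_nonneg fun a _ => hsq_nonneg a)]
    exact Finset.sum_le_sum_of_subset_of_nonneg hR fun a _ _ => hsq_nonneg a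
  obtain ⟨δ, hδ, hδne⟩ : ∃ δ > 0, ∀ a : {z | G z = 0}, δ ≤ ‖(a : ℂ)‖ := by
    obtain ⟨δ, hδ, h⟩ := Metric.eventually_nhds_iff.1
      (hG.continuous.continuousAt.eventually_ne hG0)
    refine ⟨δ, hδ, fun a => ?_⟩
    by_contra hlt
    exact h (y := a) (by simpa using hlt) a.2
  have hsummable : Summable fun a : {z | G z = 0} => 1 / (a : ℂ) ^ (k + 1) := by
    refine Summable.of_norm_bounded (hsummable2.mul_left (1 / δ ^ (k - 1))) fun a => ?_
    obtain ⟨j, rfl⟩ : ∃ j, k = j + 1 := ⟨k - 1, by omega⟩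
    have h2 := hδne a
    have h1 : 0 < ‖(a : ℂ)‖ := hδ.trans_le h2
    rw [norm_div, norm_one, norm_pow, add_tsub_cancel_right, add_assoc, pow_add, one_div_mul_one_div]
    gcongr
  have h3 := hsummable.hasSum
  rwa [tendsto_nhds_unique (h3.comp hFtop) (hlim k hk)] at h3

/-! ### The Riccati equation of `-G'/G` and the power sums for `G` -/

section Coulomb

variable {L η : ℝ}

open PowerSeries

/-- The polynomial `ρ ^ 2 - 2 η ρ - L (L + 1)`. -/
def coulombQ (L η : ℝ) : PowerSeries ℝ := X ^ 2 - C (2 * η) * X - C (L * (L + 1))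

/-- The power series of minus the logarithmic derivative of `coulombG`. -/
def coulombLogSeries (L η : ℝ) : PowerSeries ℝ :=
  -derivative ℝ (coulombGSeries L η) * (coulombGSeries L η)⁻¹

lemma constantCoeff_coulombGSeries : constantCoeff (coulombGSeries L η) = L + 1 := by
  simp [coulombGSeries, coulombSeries, coulombCoeff]

lemma coulombGSeries_ne_zero (hL : -1 < L) : coulombGSeries L η ≠ 0 := by
  intro h
  have := constantCoeff_coulombGSeries (L := L) (η := η)
  rw [h, map_zero] at this
  linarith

lemma derivative_coulombGSeries_eq (hL : -1 < L) :
    derivative ℝ (coulombGSeries L η) = -coulombLogSeries L η * coulombGSeries L η := by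
  have h : constantCoeff (coulombGSeries L η) ≠ 0 := by
    rw [constantCoeff_coulombGSeries]
    linarith
  rw [coulombLogSeries]
  linear_combination -derivative ℝ (coulombGSeries L η) * PowerSeries.inv_mul_cancel _ h

lemma coeff_zero_coulombLogSeries (hL : -1 < L) :
    coeff 0 (coulombLogSeries L η) = -coulombP L η := by
  have hL1 : L + 1 ≠ 0 := by linarith
  have h0 : constantCoeff (coulombSeries L η) = 1 := by
    simp [coulombSeries, coulombCoeff]
  have h1 : constantCoeff (derivative ℝ (coulombSeries L η)) = η / (L + 1) := by
    rw [← coeff_zero_eq_constantCoeff_apply, coeff_derivative]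
    simp [coulombSeries, coulombCoeff]
  have h := congrArg constantCoeff (derivative_coulombGSeries_eq (η := η) hL)
  rw [derivative_coulombGSeries hL] at h
  simp only [map_sub, map_mul, map_neg, constantCoeff_C, constantCoeff_X, h0, h1,
    constantCoeff_coulombGSeries] at h
  rw [coeff_zero_eq_constantCoeff_apply, coulombP]
  field_simp at h ⊢
  linear_combination h

/-- With `Q = X² - 2ηX - L(L+1)`, both `XG' + LG = -Qφ` and `XG'' + (2L+2)G' + (X-2η)G = -2(X-η)φ`
hold. Eliminating `φ`, putting `G' = -YG`, `G'' = (Y²-Y')G` and cancelling `G` gives the equation.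
-/
lemma coulombLogSeries_riccati (hL : -1 < L) :
    coulombQ L η * (X * (coulombLogSeries L η ^ 2 - derivative ℝ (coulombLogSeries L η))
      - C (2 * L + 2) * coulombLogSeries L η + X - C (2 * η)) =
    2 * (X - C η) * (C L - X * coulombLogSeries L η) := by
  have hode := coulombSeries_ode (η := η) hL
  have h1 := derivative_coulombGSeries (η := η) hL
  have h2 := derivative_coulombGSeries_eq (η := η) hL
  have h1' := congrArg (derivative ℝ) h1
  have h2' := congrArg (derivative ℝ) h2
  have hG : coulombGSeries L η =
    C (L + 1) * coulombSeries L η + X * derivative ℝ (coulombSeries L η) := rfl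
  have hne := coulombGSeries_ne_zero (η := η) hL
  refine mul_right_cancel₀ hne ?_
  unfold coulombQ
  generalize coulombGSeries L η = G at *
  generalize coulombLogSeries L η = Y at *
  generalize coulombSeries L η = P at *
  simp only [map_add, map_sub, map_neg, Derivation.leibniz, derivative_C, derivative_X, smul_eq_mul,
    map_mul, map_one, map_ofNat] at *
  have hc2 : derivative ℝ (2 : PowerSeries ℝ) = 0 := by
    rw [show (2 : PowerSeries ℝ) = C 2 from (map_ofNat C 2).symm]
    exact derivative_C
  rw [hc2] at h1'
  generalize derivative ℝ (derivative ℝ G) = G2 at *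
  generalize derivative ℝ (derivative ℝ P) = P2 at *
  generalize derivative ℝ G = G1 at *
  generalize derivative ℝ P = P1 at *
  generalize derivative ℝ Y = Y1 at *
  have e1 : X * G1 + C L * G = -(X ^ 2 - 2 * C η * X - C L * (C L + 1)) * P := by
    rw [h1, hG]
    ring
  have e2 : X * G2 + (2 * C L + 2) * G1 + (X - 2 * C η) * G = -(2 * (X - C η)) * P := by
    linear_combination X * h1' + (2 * C L + 2) * h1 + (X - 2 * C η) * hG - C L * hode
  linear_combination (X ^ 2 - 2 * C η * X - C L * (C L + 1)) * e2 - 2 * (X - C η) * e1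
    - (X ^ 2 - 2 * C η * X - C L * (C L + 1)) * X * h2'
    + (X ^ 2 - 2 * C η * X - C L * (C L + 1)) * X * Y * h2
    - (X ^ 2 - 2 * C η * X - C L * (C L + 1)) * (2 * C L + 2) * h2 + 2 * (X - C η) * X * h2

lemma norm_coulombPhi_le (hL : -1 < L) (z : ℂ) :
    ‖coulombPhi L η z‖ ≤ Real.exp ((2 * |η| + 1 + |η| / (L + 1)) * ‖z‖) := by
  have hL1 : 0 < L + 1 := by linarith
  have h1 := hasSum_coulombPhi (η := η) hL z
  rw [← h1.tsum_eq, Real.exp_eq_exp_ℝ]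
  refine tsum_of_norm_bounded (NormedSpace.expSeries_div_hasSum_exp _) fun n => ?_
  rw [norm_mul, norm_pow, Complex.norm_real, Real.norm_eq_abs, mul_pow, mul_div_right_comm]
  gcongr
  exact coulombCoeff_bound hL η n

/-- `φ` has exponential type by `coulombCoeff_bound`, and Cauchy's estimate on unit circles carries
this over to `φ'`. The summand `1` in the exponent supplies the positive constant `A` of
`hasSum_inv_zeros`. -/
lemma exists_norm_coulombG_le (hL : -1 < L) :
    ∃ K : ℝ, 0 ≤ K ∧ ∀ z, ‖coulombG L η z‖ ≤ ‖coulombG L η 0‖ * Real.exp (1 + K * ‖z‖) := by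
  have hL1 : 0 < L + 1 := by linarith
  set K : ℝ := 2 * |η| + 1 + |η| / (L + 1) with hK
  have hK0 : 0 ≤ K := by positivity
  refine ⟨K + Real.exp K / (L + 1), by positivity, fun z => ?_⟩
  have h1 := norm_coulombPhi_le (η := η) hL z
  have h2 : ‖deriv (coulombPhi L η) z‖ ≤ Real.exp (K * (‖z‖ + 1)) := by
    have := Complex.norm_deriv_le_of_forall_mem_sphere_norm_le (c := z) (R := 1)
      (C := Real.exp (K * (‖z‖ + 1))) one_pos (differentiable_coulombPhi hL η).diffContOnCl
      (fun w hw => (norm_coulombPhi_le hL w).trans (by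
        have hw' : ‖w‖ ≤ ‖z‖ + 1 := by
          have h3 : ‖w - z‖ = 1 := by simpa using hw
          have h4 := norm_le_norm_add_norm_sub' w z
          linarith
        gcongr))
    simpa using this
  have hn : ‖(L : ℂ) + 1‖ = L + 1 := by
    rw [← Complex.ofReal_one, ← Complex.ofReal_add, Complex.norm_real, Real.norm_of_nonneg hL1.le]
  rw [coulombG_zero, hn]
  calc ‖coulombG L η z‖ ≤ (L + 1) * Real.exp (K * ‖z‖) + ‖z‖ * Real.exp (K * (‖z‖ + 1)) := by
        refine (norm_add_le _ _).trans ?_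
        rw [norm_mul, norm_mul, hn]
        gcongr
    _ = (L + 1) * Real.exp (K * ‖z‖) * (Real.exp K / (L + 1) * ‖z‖ + 1) := by
        rw [mul_add K, Real.exp_add, mul_one]
        field_simp
        ring
    _ ≤ (L + 1) * Real.exp (K * ‖z‖) * Real.exp (Real.exp K / (L + 1) * ‖z‖) := by
        gcongr
        exact Real.add_one_le_exp _
    _ = (L + 1) * Real.exp ((K + Real.exp K / (L + 1)) * ‖z‖) := by
        rw [mul_assoc, ← Real.exp_add, ← add_mul]
    _ ≤ _ := by
        gcongr
        linarith

lemma coulombG_zero_ne_zero (hL : -1 < L) : coulombG L η 0 ≠ 0 := by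
  rw [coulombG_zero]
  have : L + 1 ≠ 0 := by linarith
  exact_mod_cast this

lemma taylorAtZero_deriv_coulombG (hL : -1 < L) :
    taylorAtZero (deriv (coulombG L η)) =
      -PowerSeries.map Complex.ofRealHom (coulombLogSeries L η) * taylorAtZero (coulombG L η) := by
  rw [taylorAtZero_deriv, taylorAtZero_coulombG hL, ← map_derivative,
    derivative_coulombGSeries_eq hL, map_mul, map_neg]

lemma coulombDerivZeros_eq (hL : -1 < L) :
    coulombDerivZeros L η = {z | coulombG L η z = 0} := by
  ext z
  have hC : (coulombC L η : ℂ) ≠ 0 := by exact_mod_cast (coulombC_pos hL η).ne'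
  have hF : coulombFDeriv L η z = (coulombC L η : ℂ) * z ^ (L : ℂ) * coulombG L η z := rfl
  simp only [coulombDerivZeros, Set.mem_ofPred_eq, hF]
  constructor
  · rintro ⟨hz, h⟩
    exact (mul_eq_zero.1 h).resolve_left (mul_ne_zero hC (by simp [Complex.cpow_eq_zero_iff, hz]))
  · intro h
    refine ⟨?_, by rw [h, mul_zero]⟩
    rintro rfl
    exact coulombG_zero_ne_zero hL h

lemma hasSum_inv_coulombG_zeros (hL : -1 < L) {k : ℕ} (hk : 1 ≤ k) :
    HasSum (fun a : {z | coulombG L η z = 0} => 1 / (a : ℂ) ^ (k + 1))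
      ((coeff k (coulombLogSeries L η) : ℝ) : ℂ) := by
  obtain ⟨K, hK, hbd⟩ := exists_norm_coulombG_le (η := η) hL
  have h := hasSum_inv_zeros (differentiable_coulombG hL) (coulombG_zero_ne_zero hL)
    one_pos hK hbd (fun z hz => deriv_coulombG_ne_zero hL hz)
    (fun z hz => im_eq_zero_of_coulombG_eq_zero hL hz) (taylorAtZero_deriv_coulombG hL) hk
  simpa using h

/-- If every zero had square `M`, the power sums would satisfy `M Y_{k+2} = Y_k`, so `(M - X²)Y`
would be a polynomial, which the Riccati equation excludes. The argument includes the case of no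
zeros at all, so it also proves that zeros exist. -/
lemma exists_coulombG_zero_sq_ne (hL : -1 < L) {M : ℝ} (hM : 0 < M) :
    ∃ w : ℂ, coulombG L η w = 0 ∧ w ^ 2 ≠ M := by
  by_contra! hcon
  set Y := coulombLogSeries L η with hY
  have hrec : ∀ k, 1 ≤ k → M * coeff (k + 2) Y = coeff k Y := by
    intro k hk
    have h1 := (hasSum_inv_coulombG_zeros (η := η) hL (show 1 ≤ k + 2 by omega)).mul_left (M : ℂ)
    have h2 := hasSum_inv_coulombG_zeros (η := η) hL hk
    have h3 : (fun a : {z | coulombG L η z = 0} => (M : ℂ) * (1 / (a : ℂ) ^ (k + 2 + 1))) =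
        fun a : {z | coulombG L η z = 0} => 1 / (a : ℂ) ^ (k + 1) := by
      ext a
      have ha := hcon a a.2
      have hM' : (M : ℂ) ≠ 0 := by exact_mod_cast hM.ne'
      have ha0 : (a : ℂ) ≠ 0 := by
        intro h0
        rw [h0] at ha
        exact hM' (by rw [← ha]; simp)
      rw [← ha]
      field_simp
      ring
    rw [h3] at h1
    exact_mod_cast h1.unique h2
  set b0 := M * coeff 0 Y
  set b1 := M * coeff 1 Y
  set b2 := M * coeff 2 Y - coeff 0 Y
  -- The degree is `2` rather than `1` because `Y_0` is not a power sum and `M Y_2 = Y_0` is not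
  -- available.
  have hB : (C M - X ^ 2) * Y = C b0 + C b1 * X + C b2 * X ^ 2 := by
    ext n
    rw [sub_mul, map_sub, map_add, map_add, coeff_C_mul, coeff_C_mul, coeff_C_mul,
      coeff_X_pow_mul', coeff_C, coeff_X, coeff_X_pow]
    match n with
    | 0 => simp [b0]
    | 1 => simp [b1]
    | 2 => simp [b2]
    | (n + 3) =>
      have := hrec (n + 1) (by omega)
      simp
      linear_combination this
  have hB' := congrArg (derivative ℝ) hB
  have hric := coulombLogSeries_riccati (η := η) hL
  rw [← hY] at hric
  unfold coulombQ at hric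
  simp only [pow_two, map_add, map_sub, Derivation.leibniz, derivative_C, derivative_X,
    smul_eq_mul] at hB'
  -- The Riccati equation multiplied by `(M - X²)²`, a polynomial identity of formal degree `7`.
  have hpoly : (((Polynomial.X ^ 2 - Polynomial.C (2 * η) * Polynomial.X
        - Polynomial.C (L * (L + 1))) *
      (Polynomial.X * ((Polynomial.C b0 + Polynomial.C b1 * Polynomial.X
          + Polynomial.C b2 * Polynomial.X ^ 2) ^ 2
        - (Polynomial.C M - Polynomial.X ^ 2) * (Polynomial.C b1 + 2 * Polynomial.C b2 * Polynomial.X)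
        - 2 * Polynomial.X * (Polynomial.C b0 + Polynomial.C b1 * Polynomial.X
          + Polynomial.C b2 * Polynomial.X ^ 2))
      - Polynomial.C (2 * L + 2) * (Polynomial.C M - Polynomial.X ^ 2) * (Polynomial.C b0
          + Polynomial.C b1 * Polynomial.X + Polynomial.C b2 * Polynomial.X ^ 2)
      + (Polynomial.X - Polynomial.C (2 * η)) * (Polynomial.C M - Polynomial.X ^ 2) ^ 2)
      - 2 * (Polynomial.X - Polynomial.C η) * (Polynomial.C L * (Polynomial.C M - Polynomial.X ^ 2) ^ 2
        - Polynomial.X * (Polynomial.C M - Polynomial.X ^ 2) * (Polynomial.C b0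
          + Polynomial.C b1 * Polynomial.X + Polynomial.C b2 * Polynomial.X ^ 2)) :
      Polynomial ℝ)) = 0 := by
    apply Polynomial.coe_injective
    push_cast
    rw [← hB]
    generalize derivative ℝ Y = Y1 at *
    have hc2 : ((2 : Polynomial ℝ) : PowerSeries ℝ) = 2 := by
      exact_mod_cast map_ofNat (Polynomial.coeToPowerSeries.ringHom (R := ℝ)) 2
    rw [hc2]
    linear_combination (C M - X ^ 2) ^ 2 * hric
      + (X ^ 2 - C (2 * η) * X - C (L * (L + 1))) * X * (C M - X ^ 2) * hB'
  have heval := fun x : ℝ => congrArg (Polynomial.eval x) hpoly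
  simp only [Polynomial.eval_add, Polynomial.eval_sub, Polynomial.eval_mul, Polynomial.eval_pow,
    Polynomial.eval_X, Polynomial.eval_C, Polynomial.eval_ofNat, Polynomial.eval_zero] at heval
  -- The coefficient of `X^7`, extracted as the seventh finite difference over `7! = 5040`.
  have hlead : b2 ^ 2 + 1 = 0 := by
    linear_combination (1 / 5040 : ℝ) * (heval 7 - 7 * heval 6 + 21 * heval 5 - 35 * heval 4
      + 35 * heval 3 - 21 * heval 2 + 7 * heval 1 - heval 0)
  nlinarith [sq_nonneg b2]

/-! ### The coefficients `a_n` and the recurrences for the power sums -/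

/-- The power series with coefficients `genCoeff`. -/
def genSeries (L η : ℝ) : PowerSeries ℝ :=
  2 * (X - C η) * (X ^ 2 - C (2 * η) * X - C (L * (L + 1)))⁻¹

lemma coeff_genSeries (n : ℕ) : coeff n (genSeries L η) = genCoeff L η n := rfl

lemma genSeries_mul_coulombQ (hL : -1 < L) (hL0 : L ≠ 0) :
    genSeries L η * coulombQ L η = 2 * (X - C η) := by
  have hL1 : L + 1 ≠ 0 := by linarith
  have h : constantCoeff (X ^ 2 - C (2 * η) * X - C (L * (L + 1)) : PowerSeries ℝ) ≠ 0 := by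
    simp [hL0, hL1]
  rw [genSeries, coulombQ, mul_assoc, PowerSeries.inv_mul_cancel _ h, mul_one]

lemma genCoeff_zero (hL : -1 < L) (hL0 : L ≠ 0) : genCoeff L η 0 = 2 * η / (L * (L + 1)) := by
  have hL1 : L + 1 ≠ 0 := by linarith
  have h := congrArg (coeff 0) (genSeries_mul_coulombQ (η := η) hL hL0)
  rw [coulombQ, mul_sub, mul_sub, ← mul_assoc, map_sub, map_sub, coeff_mul_X_pow', coeff_mul_C,
    coeff_genSeries, coeff_zero_mul_X, show (2 : PowerSeries ℝ) = C 2 from (map_ofNat C 2).symm,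
    coeff_C_mul] at h
  simp at h
  field_simp
  linear_combination h

lemma genCoeff_one (hL : -1 < L) (hL0 : L ≠ 0) :
    genCoeff L η 1 = -(2 * (L ^ 2 + L + 2 * η ^ 2) / (L ^ 2 * (L + 1) ^ 2)) := by
  have hL1 : L + 1 ≠ 0 := by linarith
  have h := congrArg (coeff 1) (genSeries_mul_coulombQ (η := η) hL hL0)
  rw [coulombQ, mul_sub, mul_sub, ← mul_assoc, map_sub, map_sub, coeff_mul_X_pow', coeff_mul_C,
    coeff_genSeries, coeff_succ_mul_X 0, coeff_mul_C, coeff_genSeries, genCoeff_zero hL hL0,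
    show (2 : PowerSeries ℝ) = C 2 from (map_ofNat C 2).symm, coeff_C_mul, map_sub, coeff_one_X,
    coeff_C] at h
  simp [coeff_genSeries] at h
  field_simp at h ⊢
  linear_combination -h

lemma genCoeff_two (hL : -1 < L) (hL0 : L ≠ 0) :
    genCoeff L η 2 = 2 * η * (3 * L ^ 2 + 3 * L + 4 * η ^ 2) / (L ^ 3 * (L + 1) ^ 3) := by
  have hL1 : L + 1 ≠ 0 := by linarith
  have h := congrArg (coeff 2) (genSeries_mul_coulombQ (η := η) hL hL0)
  rw [coulombQ, mul_sub, mul_sub, ← mul_assoc, map_sub, map_sub, coeff_mul_X_pow', coeff_mul_C,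
    coeff_genSeries, coeff_succ_mul_X 1, coeff_mul_C, coeff_genSeries, genCoeff_one hL hL0,
    if_pos le_rfl, Nat.sub_self, coeff_genSeries, genCoeff_zero hL hL0,
    show (2 : PowerSeries ℝ) = C 2 from (map_ofNat C 2).symm, coeff_C_mul, map_sub, coeff_X,
    coeff_C] at h
  simp at h
  field_simp at h ⊢
  linear_combination -h

/-- The Taylor series of the quotient and the formal quotient have the same product with the nonzero
series of the denominator, so they agree. -/
lemma eventually_hasSum_genCoeff (hL : -1 < L) (hL0 : L ≠ 0) :
    ∀ᶠ x : ℝ in 𝓝 0, HasSum (fun n : ℕ => genCoeff L η n * x ^ n)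
      (2 * (x - η) / (x ^ 2 - 2 * η * x - L * (L + 1))) := by
  have hL1 : L + 1 ≠ 0 := by linarith
  set q : ℂ → ℂ := fun z => z * z + ((-2 * η) * z + -(L * (L + 1))) with hq
  have hqd : Differentiable ℂ q := by fun_prop
  have hq0 : q 0 ≠ 0 := by
    have : L * (L + 1) ≠ 0 := mul_ne_zero hL0 hL1
    simp only [hq, mul_zero, zero_add, ne_eq, neg_eq_zero]
    exact_mod_cast this
  obtain ⟨δ, hδ, hne⟩ := Metric.eventually_nhds_iff.1
    (hqd.continuous.continuousAt.eventually_ne hq0)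
  set f : ℂ → ℂ := fun z => (2 * z + -2 * η) / q z with hf
  have hfd : DifferentiableOn ℂ f (Metric.ball 0 δ) :=
    DifferentiableOn.div (by fun_prop) hqd.differentiableOn fun z hz => hne hz
  have hnhds : Metric.ball (0 : ℂ) δ ∈ 𝓝 0 := Metric.ball_mem_nhds _ hδ
  have hfa : AnalyticAt ℂ f 0 := hfd.analyticAt hnhds
  have hmul : (fun z => f z * q z) =ᶠ[𝓝 0] fun z => 2 * z + -2 * (η : ℂ) := by
    filter_upwards [hnhds] with z hz
    exact div_mul_cancel₀ _ (hne hz)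
  have hTq : taylorAtZero q = PowerSeries.map Complex.ofRealHom (coulombQ L η) := by
    rw [hq, taylorAtZero_add (by fun_prop) (by fun_prop),
      taylorAtZero_mul (by fun_prop) (by fun_prop), taylorAtZero_add (by fun_prop) (by fun_prop),
      taylorAtZero_mul (by fun_prop) (by fun_prop), taylorAtZero_const, taylorAtZero_const,
      taylorAtZero_id, coulombQ]
    simp
    ring
  have hTr : taylorAtZero (fun z => 2 * z + -2 * (η : ℂ)) = C 2 * X + C (-2 * (η : ℂ)) := by
    rw [taylorAtZero_add (by fun_prop) (by fun_prop),
      taylorAtZero_mul (by fun_prop) (by fun_prop), taylorAtZero_const, taylorAtZero_const,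
      taylorAtZero_id]
  have hT := taylorAtZero_congr hmul
  rw [taylorAtZero_mul hfa (hqd.analyticAt 0), hTr] at hT
  have hgen := congrArg (PowerSeries.map Complex.ofRealHom)
    (genSeries_mul_coulombQ (η := η) hL hL0)
  rw [map_mul, ← hTq] at hgen
  have hTne : taylorAtZero q ≠ 0 := by
    intro h0
    have := congrArg (PowerSeries.coeff 0) h0
    rw [coeff_taylorAtZero] at this
    simp [hq0] at this
  have hTf : taylorAtZero f = PowerSeries.map Complex.ofRealHom (genSeries L η) := by
    refine mul_right_cancel₀ hTne (hT.trans (Eq.trans ?_ hgen.symm))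
    rw [map_mul (PowerSeries.map _), map_sub (PowerSeries.map _), map_ofNat (PowerSeries.map _),
      PowerSeries.map_X, PowerSeries.map_C, map_mul C, map_neg C, map_ofNat C,
      Complex.ofRealHom_eq_coe]
    ring
  filter_upwards [Metric.ball_mem_nhds (0 : ℝ) hδ] with x hx
  have hx' : (x : ℂ) ∈ Metric.ball (0 : ℂ) δ := by simpa using hx
  have h := hasSum_taylorAtZero hfd hx'
  rw [hTf] at h
  rw [← Complex.hasSum_ofReal]
  convert h using 1
  · ext n
    simp [coeff_genSeries]
  · simp only [hf, hq]
    push_cast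
    congr 1 <;> ring

/-- The coefficient of `X^(n+1)` in the Riccati equation after cancelling `Q`: `X(Y² - Y') - (2L+2)Y
+ X - 2η = (∑ a_n X^n)(L - XY)`. -/
lemma coeff_coulombLogSeries_recurrence (hL : -1 < L) (hL0 : L ≠ 0) (n : ℕ) :
    (2 * L + n + 3) * coeff (n + 1) (coulombLogSeries L η) =
      (if n = 0 then 1 else 0) - L * genCoeff L η (n + 1)
        + ∑ m ∈ Finset.range (n + 1), genCoeff L η m * coeff (n - m) (coulombLogSeries L η)
        + ∑ m ∈ Finset.range (n + 1),
          coeff m (coulombLogSeries L η) * coeff (n - m) (coulombLogSeries L η) := by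
  have hric := coulombLogSeries_riccati (η := η) hL
  have hgen := genSeries_mul_coulombQ (η := η) hL hL0
  have hQ : coulombQ L η ≠ 0 := by
    intro h0
    have := congrArg constantCoeff h0
    have hL1 : L + 1 ≠ 0 := by linarith
    simp [coulombQ, hL0, hL1] at this
  rw [← hgen, mul_comm (genSeries L η), mul_assoc] at hric
  have h := congrArg (coeff (n + 1)) (mul_left_cancel₀ hQ hric)
  rw [mul_sub (genSeries L η), mul_left_comm (genSeries L η), mul_comm (genSeries L η) (C L)] at h
  simp only [LinearMap.map_sub, LinearMap.map_add, coeff_succ_X_mul, coeff_C_mul, coeff_X, coeff_C,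
    coeff_derivative, pow_two] at h
  simp only [coeff_mul, Finset.Nat.sum_antidiagonal_eq_sum_range_succ_mk, coeff_genSeries] at h
  simp only [Nat.add_eq_right, Nat.add_eq_zero_iff, one_ne_zero, and_false, if_false] at h
  linear_combination -h

lemma coulombLogSeries_recurrence_add_three (hL : -1 < L) (hL0 : L ≠ 0) (n : ℕ) :
    (2 * L + n + 5) * coeff (n + 3) (coulombLogSeries L η) =
      -L * genCoeff L η (n + 3) - coulombP L η * genCoeff L η (n + 2)
        + ∑ m ∈ Finset.range (n + 2), genCoeff L η m * coeff (3 + n - m - 1) (coulombLogSeries L η)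
        + ∑ m ∈ Finset.range (n + 1), coeff (m + 2 - 1) (coulombLogSeries L η) *
          coeff (n - m + 2 - 1) (coulombLogSeries L η)
        - 2 * coulombP L η * coeff (n + 2) (coulombLogSeries L η) := by
  have h := coeff_coulombLogSeries_recurrence (η := η) hL hL0 (n + 2)
  have h0 := coeff_zero_coulombLogSeries (η := η) hL
  -- Splits off the terms that contain `Y_0 = -p̃`: the last one of the first sum, and both ends of
  -- the convolution, whence the factor `2`.
  rw [Finset.sum_range_succ, Finset.sum_range_succ _ (n + 2),
    Finset.sum_range_succ' (fun m => coeff m (coulombLogSeries L η) *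
      coeff (n + 2 - m) (coulombLogSeries L η)) (n + 1)] at h
  simp only [Nat.sub_self, h0, Nat.sub_zero] at h
  have e1 : ∑ m ∈ Finset.range (n + 2), genCoeff L η m *
      coeff (3 + n - m - 1) (coulombLogSeries L η) =
      ∑ m ∈ Finset.range (n + 2), genCoeff L η m * coeff (n + 2 - m) (coulombLogSeries L η) := by
    refine Finset.sum_congr rfl fun m _ => ?_
    rw [show 3 + n - m - 1 = n + 2 - m by omega]
  have e2 : ∑ m ∈ Finset.range (n + 1), coeff (m + 2 - 1) (coulombLogSeries L η) *
      coeff (n - m + 2 - 1) (coulombLogSeries L η) =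
      ∑ m ∈ Finset.range (n + 1), coeff (m + 1) (coulombLogSeries L η) *
        coeff (n + 1 - m) (coulombLogSeries L η) := by
    refine Finset.sum_congr rfl fun m hm => ?_
    have := Finset.mem_range.1 hm
    rw [show n + 1 - m = n - m + 2 - 1 by omega, show m + 2 - 1 = m + 1 by omega]
  rw [e1, e2]
  push_cast at h
  linear_combination h

/-! ### The radius of starlikeness -/

/-- The power series of `-z φ'(z) / φ(z)`. -/
def coulombRatioSeries (L η : ℝ) : PowerSeries ℝ :=
  -(X * derivative ℝ (coulombSeries L η)) * (coulombSeries L η)⁻¹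

lemma constantCoeff_coulombSeries : constantCoeff (coulombSeries L η) = 1 := by
  simp [coulombSeries, coulombCoeff]

lemma X_mul_derivative_coulombSeries :
    X * derivative ℝ (coulombSeries L η) = -coulombRatioSeries L η * coulombSeries L η := by
  have h : constantCoeff (coulombSeries L η) ≠ 0 := by
    rw [constantCoeff_coulombSeries]
    exact one_ne_zero
  rw [coulombRatioSeries]
  linear_combination -(X * derivative ℝ (coulombSeries L η)) * PowerSeries.inv_mul_cancel _ h

lemma coulombRatioSeries_riccati (hL : -1 < L) :
    X * derivative ℝ (coulombRatioSeries L η) + C (2 * L + 1) * coulombRatioSeries L η =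
      coulombRatioSeries L η * coulombRatioSeries L η + X ^ 2 - C (2 * η) * X := by
  have hode := coulombSeries_ode (η := η) hL
  have h1 := X_mul_derivative_coulombSeries (L := L) (η := η)
  have h2 := congrArg (derivative ℝ) h1
  have hne : coulombSeries L η ≠ 0 := by
    intro h
    have := constantCoeff_coulombSeries (L := L) (η := η)
    rw [h, map_zero] at this
    exact zero_ne_one this
  refine mul_right_cancel₀ hne ?_
  generalize coulombRatioSeries L η = S at *
  generalize coulombSeries L η = P at *
  simp only [map_add, map_neg, Derivation.leibniz, derivative_X, smul_eq_mul, map_mul, map_one,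
    map_ofNat] at *
  generalize derivative ℝ (derivative ℝ P) = P2 at *
  linear_combination X * h2 - X * hode + (2 * C L + 1) * h1 - S * h1

/-- For `n ≥ 1` the Riccati equation expresses `(n+2L+1)S_n` as a convolution plus the contributions
of `X²` and `-2ηX`, all nonnegative for `η < 0`. As `S_0 = 0`, the convolution involves only smaller
indices. -/
lemma coeff_coulombRatioSeries_nonneg (hL : -1 < L) (hη : η < 0) (n : ℕ) :
    0 ≤ coeff n (coulombRatioSeries L η) := by
  have h0 : coeff 0 (coulombRatioSeries L η) = 0 := by
    simp [coulombRatioSeries]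
  induction n using Nat.strong_induction_on with
  | _ n ih =>
    rcases n with _ | n
    · exact h0.ge
    have h := congrArg (coeff (n + 1)) (coulombRatioSeries_riccati (η := η) hL)
    simp only [LinearMap.map_sub, LinearMap.map_add, coeff_succ_X_mul, coeff_C_mul, coeff_X,
      coeff_derivative, coeff_X_pow] at h
    rw [coeff_mul] at h
    have hsum : 0 ≤ ∑ p ∈ Finset.HasAntidiagonal.antidiagonal (n + 1), coeff p.1 (coulombRatioSeries L η) *
        coeff p.2 (coulombRatioSeries L η) := by
      refine Finset.sum_nonneg fun p hp => ?_
      have hp' := Finset.HasAntidiagonal.mem_antidiagonal.1 hp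
      rcases Nat.eq_zero_or_pos p.1 with h1 | h1
      · rw [h1, h0, zero_mul]
      rcases Nat.eq_zero_or_pos p.2 with h2 | h2
      · rw [h2, h0, mul_zero]
      exact mul_nonneg (ih _ (by omega)) (ih _ (by omega))
    have hn : (0 : ℝ) ≤ n := n.cast_nonneg
    have hpos : 0 < (n : ℝ) + 1 + (2 * L + 1) := by linarith
    have hrhs : 0 ≤ ((n : ℝ) + 1 + (2 * L + 1)) * coeff (n + 1) (coulombRatioSeries L η) := by
      have e : ((n : ℝ) + 1 + (2 * L + 1)) * coeff (n + 1) (coulombRatioSeries L η) = _ :=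
        Eq.trans (by ring) h
      rw [e]
      split_ifs <;> linarith
    exact nonneg_of_mul_nonneg_right hrhs hpos

lemma hasSum_coulombPhi_ratio (hL : -1 < L) {R : ℝ} (hR : 0 < R)
    (hne : ∀ z ∈ Metric.ball (0 : ℂ) R, coulombPhi L η z ≠ 0) {z : ℂ}
    (hz : z ∈ Metric.ball (0 : ℂ) R) :
    HasSum (fun n => ((-coeff n (coulombRatioSeries L η) : ℝ) : ℂ) * z ^ n)
      (z * deriv (coulombPhi L η) z / coulombPhi L η z) := by
  have hφ := differentiable_coulombPhi hL η
  have hφ' := differentiable_deriv_coulombPhi (η := η) hL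
  set h : ℂ → ℂ := fun z => z * deriv (coulombPhi L η) z / coulombPhi L η z with hh
  have hd : DifferentiableOn ℂ h (Metric.ball 0 R) :=
    (differentiableOn_id.mul hφ'.differentiableOn).div hφ.differentiableOn hne
  have hnhds : Metric.ball (0 : ℂ) R ∈ 𝓝 0 := Metric.ball_mem_nhds _ hR
  have hmul : (fun z => h z * coulombPhi L η z) =ᶠ[𝓝 0] fun z => z * deriv (coulombPhi L η) z := by
    filter_upwards [hnhds] with z hz
    exact div_mul_cancel₀ _ (hne z hz)
  have hT := taylorAtZero_congr hmul
  rw [taylorAtZero_mul (hd.analyticAt hnhds) (hφ.analyticAt 0),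
    taylorAtZero_mul (f := fun z => z) analyticAt_id (hφ'.analyticAt 0), taylorAtZero_id, taylorAtZero_deriv,
    taylorAtZero_coulombPhi hL, ← map_derivative,
    ← PowerSeries.map_X (R := ℝ) (f := Complex.ofRealHom), ← map_mul,
    X_mul_derivative_coulombSeries, map_mul] at hT
  have hTne : PowerSeries.map Complex.ofRealHom (coulombSeries L η) ≠ 0 := by
    intro h0
    have := congrArg constantCoeff h0
    rw [← coeff_zero_eq_constantCoeff_apply, coeff_map, coeff_zero_eq_constantCoeff_apply,
      constantCoeff_coulombSeries] at this
    simp at this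
  have hsum := hasSum_taylorAtZero hd hz
  rw [mul_right_cancel₀ hTne hT] at hsum
  refine hsum.congr_fun fun n => ?_
  simp

lemma norm_coulombPhi_ratio_le (hL : -1 < L) (hη : η < 0) {R : ℝ}
    (hne : ∀ z ∈ Metric.ball (0 : ℂ) R, coulombPhi L η z ≠ 0) {z : ℂ}
    (hz : z ∈ Metric.ball (0 : ℂ) R) :
    ‖z * deriv (coulombPhi L η) z / coulombPhi L η z‖ ≤
      -(((‖z‖ : ℝ) : ℂ) * deriv (coulombPhi L η) ‖z‖ / coulombPhi L η ‖z‖).re := by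
  have hz' : ‖z‖ < R := by simpa using hz
  have hR : 0 < R := (norm_nonneg z).trans_lt hz'
  have h1 := hasSum_coulombPhi_ratio hL hR hne hz
  have h2 := hasSum_coulombPhi_ratio hL hR hne (z := ((‖z‖ : ℝ) : ℂ)) (by simpa using hz')
  have h3 := (Complex.hasSum_re h2).neg
  rw [← h1.tsum_eq]
  refine tsum_of_norm_bounded h3 fun n => ?_
  rw [norm_mul, Complex.norm_real, norm_neg,
    Real.norm_of_nonneg (coeff_coulombRatioSeries_nonneg hL hη n), norm_pow, ← Complex.ofReal_pow,
    ← Complex.ofReal_mul, Complex.ofReal_re]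
  linarith

lemma coulombG_ofReal (hL : -1 < L) (x : ℝ) : coulombG L η x = ((coulombG L η x).re : ℂ) :=
  apply_ofReal_eq_re_of_taylorAtZero_eq_map (differentiable_coulombG hL) (taylorAtZero_coulombG hL) x

lemma norm_coulombPhi_ratio_lt (hL : -1 < L) (hη : η < 0) {R : ℝ}
    (hne : ∀ z ∈ Metric.ball (0 : ℂ) R, coulombPhi L η z ≠ 0)
    (hG : ∀ z ∈ Metric.ball (0 : ℂ) R, coulombG L η z ≠ 0) {z : ℂ}
    (hz : z ∈ Metric.ball (0 : ℂ) R) :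
    ‖z * deriv (coulombPhi L η) z / coulombPhi L η z‖ < L + 1 := by
  have hz' : ‖z‖ < R := by simpa using hz
  refine (norm_coulombPhi_ratio_le hL hη hne hz).trans_lt ?_
  -- `q` has the sign of `G/φ = L + 1 + tφ'/φ`. It is positive at `0` and has no zero on `[0, ‖z‖]`,
  -- so the bound `-tφ'/φ < L + 1` persists up to `‖z‖`.
  set q : ℝ → ℝ := fun t => (coulombG L η t).re * (coulombPhi L η t).re with hq
  have hGc := (differentiable_coulombG (η := η) hL).continuous
  have hφc := (differentiable_coulombPhi hL η).continuous
  have hqc : Continuous q :=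
    (Complex.continuous_re.comp (by fun_prop)).mul (Complex.continuous_re.comp (by fun_prop))
  have hmem : ∀ t ∈ Set.Icc 0 ‖z‖, (t : ℂ) ∈ Metric.ball (0 : ℂ) R := by
    intro t ht
    have : |t| < R := by
      rw [abs_of_nonneg ht.1]
      exact ht.2.trans_lt hz'
    simpa using this
  have hqne : ∀ t ∈ Set.Icc 0 ‖z‖, q t ≠ 0 := by
    intro t ht h0
    rcases mul_eq_zero.1 h0 with h | h
    · exact hG t (hmem t ht) (by rw [coulombG_ofReal hL, h, Complex.ofReal_zero])
    · exact hne t (hmem t ht) (by rw [coulombPhi_ofReal hL, h, Complex.ofReal_zero])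
  have hq0 : 0 < q 0 := by
    simp [hq, coulombG_zero, coulombPhi_zero]
    linarith
  have hqpos : 0 < q ‖z‖ := by
    by_contra hle
    obtain ⟨t, ht, ht0⟩ := intermediate_value_Icc' (norm_nonneg z) hqc.continuousOn
      ⟨not_lt.1 hle, hq0.le⟩
    exact hqne t ht ht0
  have ha : (coulombPhi L η ‖z‖).re ≠ 0 := right_ne_zero_of_mul hqpos.ne'
  have e1 : ((‖z‖ : ℝ) : ℂ) * deriv (coulombPhi L η) ‖z‖ / coulombPhi L η ‖z‖ =
      (((coulombG L η ‖z‖).re / (coulombPhi L η ‖z‖).re - (L + 1) : ℝ) : ℂ) := by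
    have ha' : ((coulombPhi L η ‖z‖).re : ℂ) ≠ 0 := by exact_mod_cast ha
    push_cast
    rw [← coulombG_ofReal hL, ← coulombPhi_ofReal hL]
    rw [← coulombPhi_ofReal hL] at ha'
    unfold coulombG
    field_simp
    ring
  rw [e1, Complex.ofReal_re]
  have h3 : 0 < (coulombG L η ‖z‖).re / (coulombPhi L η ‖z‖).re := by
    rw [div_eq_mul_inv, ← mul_pos_iff_of_pos_right (sq_pos_of_ne_zero ha)]
    have : (coulombG L η ‖z‖).re * (coulombPhi L η ‖z‖).re⁻¹ * (coulombPhi L η ‖z‖).re ^ 2 =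
        q ‖z‖ := by
      simp only [hq]
      field_simp
    rwa [this]
  linarith

/-- At a zero `w` of `φ` of least modulus, the inequality `|yφ'| ≤ (L+1)|φ|` from the open disk
passes to the boundary and gives `wφ'(w) = 0`. Then `G` and `φ` vanish together at `w`, which is
impossible. -/
lemma coulombPhi_ne_zero_of_norm_le (hL : -1 < L) (hη : η < 0) {m : ℝ}
    (hG : ∀ z ∈ Metric.ball (0 : ℂ) m, coulombG L η z ≠ 0) {z : ℂ} (hz : ‖z‖ ≤ m) :
    coulombPhi L η z ≠ 0 := by
  intro hz0
  have hφ := differentiable_coulombPhi hL η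
  have hfin := finite_zeros_of_entire hφ (by rw [coulombPhi_zero]; exact one_ne_zero) (m + 1)
  obtain ⟨w, hw, hmin⟩ := hfin.exists_minimalFor (fun z => ‖z‖) _
    ⟨z, hz0, by linarith⟩
  have hwz : ‖w‖ ≤ m := by
    rcases le_total ‖w‖ ‖z‖ with h | h
    · exact h.trans hz
    · exact (hmin ⟨hz0, by linarith⟩ h).trans hz
  have hne : ∀ y ∈ Metric.ball (0 : ℂ) ‖w‖, coulombPhi L η y ≠ 0 := by
    intro y hy hy0
    have hy' : ‖y‖ < ‖w‖ := by simpa using hy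
    have := hmin (j := y) ⟨hy0, by linarith⟩ hy'.le
    exact absurd this (not_le.2 hy')
  have hw0 : w ≠ 0 := by
    rintro rfl
    have := hw.1
    rw [coulombPhi_zero] at this
    exact one_ne_zero this
  have hbd : ∀ y ∈ Metric.ball (0 : ℂ) ‖w‖,
      ‖y * deriv (coulombPhi L η) y‖ ≤ (L + 1) * ‖coulombPhi L η y‖ := by
    intro y hy
    have := norm_coulombPhi_ratio_lt hL hη hne
      (fun y hy => hG y (Metric.ball_subset_ball hwz hy)) hy
    rw [norm_div, div_lt_iff₀ (norm_pos_iff.2 (hne y hy))] at this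
    exact this.le
  have hc1 := hφ.continuous
  have hc2 := (differentiable_deriv_coulombPhi (η := η) hL).continuous
  have hcl : IsClosed {y : ℂ | ‖y * deriv (coulombPhi L η) y‖ ≤ (L + 1) * ‖coulombPhi L η y‖} :=
    isClosed_le (by fun_prop) (by fun_prop)
  have hwcl : w ∈ closure (Metric.ball (0 : ℂ) ‖w‖) := by
    rw [closure_ball _ (norm_ne_zero_iff.2 hw0)]
    simp
  have hφw : coulombPhi L η w = 0 := hw.1
  have h1 : ‖w * deriv (coulombPhi L η) w‖ ≤ (L + 1) * ‖coulombPhi L η w‖ :=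
    closure_minimal hbd hcl hwcl
  rw [hφw, norm_zero, mul_zero, norm_le_zero_iff] at h1
  refine coulombPhi_ne_zero_of_coulombG_eq_zero hL (w := w) ?_ hφw
  rw [coulombG, h1, hφw]
  simp

lemma mul_deriv_coulombf_div (hL : -1 < L) {R : ℝ}
    (hne : ∀ z ∈ Metric.ball (0 : ℂ) R, coulombPhi L η z ≠ 0) {z : ℂ}
    (hz : z ∈ Metric.ball (0 : ℂ) R) (hz0 : z ≠ 0) :
    z * deriv (coulombf L η) z / coulombf L η z =
      ((L + 1 : ℝ) : ℂ)⁻¹ *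
        ((L + 1 : ℝ) + z * deriv (coulombPhi L η) z / coulombPhi L η z) := by
  have hL1 : (L : ℂ) + 1 ≠ 0 := by
    have : L + 1 ≠ 0 := by linarith
    exact_mod_cast this
  have hR : 0 < R := Metric.pos_of_mem_ball hz
  obtain ⟨hd, -, hexp⟩ := coulombLogPhi_spec hL η hR hne
  have hg := (hd.differentiableAt (Metric.isOpen_ball.mem_nhds hz)).hasDerivAt
  have hlog : deriv (coulombPhi L η) z =
      coulombPhi L η z * deriv (coulombLogPhi L η) z := by
    have h1 : HasDerivAt (coulombPhi L η) _ z := hg.cexp.congr_of_eventuallyEq (by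
      filter_upwards [Metric.isOpen_ball.mem_nhds hz] with w hw using (hexp w hw).symm)
    rw [h1.deriv, hexp z hz]
  have hf : HasDerivAt (coulombf L η) _ z :=
    (hasDerivAt_id z).mul ((hg.div_const ((L : ℂ) + 1)).cexp)
  have hφz := hne z hz
  rw [hf.deriv, hlog, coulombf]
  have he := Complex.exp_ne_zero (coulombLogPhi L η z / ((L : ℂ) + 1))
  simp only [id]
  push_cast
  field_simp

lemma starlikeRadius_coulombf (hL : -1 < L) (hη : η < 0) {w : ℂ} (hw : coulombG L η w = 0)
    (hmin : ∀ z, coulombG L η z = 0 → ‖w‖ ≤ ‖z‖) :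
    starlikeRadius 0 (coulombf L η) = ‖w‖ := by
  have hw0 : w ≠ 0 := by
    rintro rfl
    exact coulombG_zero_ne_zero hL hw
  have hm : 0 < ‖w‖ := norm_pos_iff.2 hw0
  have hG : ∀ z ∈ Metric.ball (0 : ℂ) ‖w‖, coulombG L η z ≠ 0 := by
    intro z hz hz0
    have : ‖z‖ < ‖w‖ := by simpa using hz
    exact absurd (hmin z hz0) (not_le.2 this)
  have hφ : ∀ z ∈ Metric.closedBall (0 : ℂ) ‖w‖, coulombPhi L η z ≠ 0 := fun z hz =>
    coulombPhi_ne_zero_of_norm_le hL hη hG (by simpa using hz)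
  have hφb : ∀ z ∈ Metric.ball (0 : ℂ) ‖w‖, coulombPhi L η z ≠ 0 := fun z hz =>
    hφ z (Metric.ball_subset_closedBall hz)
  refine IsGreatest.csSup_eq ⟨⟨hm, (coulombf_spec hL η hm hφb).1, fun z hz hz0 => ?_⟩, ?_⟩
  · rw [mul_deriv_coulombf_div hL hφb hz hz0, ← Complex.ofReal_inv, Complex.re_ofReal_mul,
      Complex.add_re, Complex.ofReal_re]
    have h1 := norm_coulombPhi_ratio_lt hL hη hφb hG hz
    have h2 := Complex.abs_re_le_norm (z * deriv (coulombPhi L η) z / coulombPhi L η z)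
    have h3 := neg_abs_le (z * deriv (coulombPhi L η) z / coulombPhi L η z).re
    exact mul_pos (inv_pos.2 (by linarith)) (by linarith)
  · rintro r ⟨-, -, hr⟩
    by_contra hlt
    have hlt' : ‖w‖ < r := not_le.1 hlt
    have hopen : IsOpen {z : ℂ | coulombPhi L η z ≠ 0} :=
      isOpen_ne_fun (differentiable_coulombPhi hL η).continuous continuous_const
    -- The formula for `z f'/f` requires an open disk free of zeros of `φ`, and `w` lies on the
    -- boundary of the given one; compactness enlarges it.
    obtain ⟨δ, hδ, hsub⟩ := (isCompact_closedBall (0 : ℂ) ‖w‖).exists_thickening_subset_open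
      hopen hφ
    rw [thickening_closedBall hδ hm.le] at hsub
    have h1 := hr w (by simpa using hlt') hw0
    rw [mul_deriv_coulombf_div hL (R := δ + ‖w‖) hsub (by simpa using hδ) hw0] at h1
    have h2 : ((L + 1 : ℝ) : ℂ) + w * deriv (coulombPhi L η) w / coulombPhi L η w = 0 := by
      have h3 : coulombPhi L η w ≠ 0 := hφ w (by simp)
      unfold coulombG at hw
      push_cast
      field_simp
      linear_combination hw
    rw [h2] at h1
    simp at h1

/-! ### The Euler–Rayleigh inequalities -/

lemma exists_coulombG_zero_norm_minimal (hL : -1 < L) :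
    ∃ w : ℂ, coulombG L η w = 0 ∧ ∀ z, coulombG L η z = 0 → ‖w‖ ≤ ‖z‖ := by
  obtain ⟨w₀, hw₀, -⟩ := exists_coulombG_zero_sq_ne (η := η) hL one_pos
  obtain ⟨w, hw, hmin⟩ := (finite_zeros_of_entire (differentiable_coulombG hL)
    (coulombG_zero_ne_zero (η := η) hL) (‖w₀‖ + 1)).exists_minimalFor (fun z => ‖z‖) _
    ⟨w₀, hw₀, by linarith⟩
  refine ⟨w, hw.1, fun z hz => ?_⟩
  by_contra hlt
  have hlt' := not_le.1 hlt
  exact hlt (hmin (j := z) ⟨hz, hlt'.trans hw.2⟩ hlt'.le)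

lemma sq_eq_norm_sq_of_coulombG_eq_zero (hL : -1 < L) {z : ℂ} (hz : coulombG L η z = 0) :
    z ^ 2 = ((‖z‖ ^ 2 : ℝ) : ℂ) := by
  have him := im_eq_zero_of_coulombG_eq_zero hL hz
  have h1 : z = (z.re : ℂ) := Complex.ext (by simp) (by simp [him])
  rw [h1, Complex.norm_real, Real.norm_eq_abs, sq_abs]
  push_cast
  rfl

lemma hasSum_inv_norm_coulombG_zeros (hL : -1 < L) {s : ℕ} (hs : 1 ≤ s) :
    HasSum (fun a : {z | coulombG L η z = 0} => 1 / (‖(a : ℂ)‖ ^ 2) ^ s)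
      (coeff (2 * s - 1) (coulombLogSeries L η)) := by
  rw [← Complex.hasSum_ofReal]
  refine (hasSum_inv_coulombG_zeros (η := η) hL (show 1 ≤ 2 * s - 1 by omega)).congr_fun fun a => ?_
  rw [show 2 * s - 1 + 1 = 2 * s by omega, pow_mul, sq_eq_norm_sq_of_coulombG_eq_zero hL a.2]
  push_cast
  rfl

/-- The Euler-Rayleigh inequalities for the zero of smallest modulus. -/
lemma euler_rayleigh_coulombG (hL : -1 < L) {w : ℂ} (hw : coulombG L η w = 0)
    (hmin : ∀ z, coulombG L η z = 0 → ‖w‖ ≤ ‖z‖) {s : ℕ} (hs : 1 ≤ s) :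
    coeff (2 * s - 1) (coulombLogSeries L η) ^ (-(1 / (s : ℝ))) < ‖w‖ ^ 2 ∧
      ‖w‖ ^ 2 < coeff (2 * s - 1) (coulombLogSeries L η) /
        coeff (2 * s + 2 - 1) (coulombLogSeries L η) := by
  classical
  have hpos : ∀ z, coulombG L η z = 0 → 0 < ‖z‖ := by
    intro z hz
    rw [norm_pos_iff]
    rintro rfl
    exact coulombG_zero_ne_zero hL hz
  have hm := hpos w hw
  -- A zero of strictly larger modulus, the source of both strict inequalities. It rules out that
  -- `±‖w‖` are the only zeros.
  obtain ⟨v, hv, hvw⟩ := exists_coulombG_zero_sq_ne (η := η) hL (M := ‖w‖ ^ 2) (by positivity)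
  have hvw' : ‖w‖ < ‖v‖ := by
    refine lt_of_le_of_ne (hmin v hv) fun h => hvw ?_
    rw [sq_eq_norm_sq_of_coulombG_eq_zero hL hv, h]
  have hsum := hasSum_inv_norm_coulombG_zeros (η := η) hL hs
  have hsum' := hasSum_inv_norm_coulombG_zeros (η := η) hL (show 1 ≤ s + 1 by omega)
  rw [show 2 * (s + 1) - 1 = 2 * s + 2 - 1 by omega] at hsum'
  generalize coeff (2 * s - 1) (coulombLogSeries L η) = A at *
  generalize coeff (2 * s + 2 - 1) (coulombLogSeries L η) = B at *
  have hne : (⟨w, hw⟩ : {z | coulombG L η z = 0}) ≠ ⟨v, hv⟩ := by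
    intro h
    exact hvw'.ne (congrArg (fun a : {z | coulombG L η z = 0} => ‖(a : ℂ)‖) h)
  have hvpos := hpos v hv
  have hA : 1 / (‖w‖ ^ 2) ^ s < A := by
    have h := sum_le_hasSum {⟨w, hw⟩, ⟨v, hv⟩} (fun a _ => by positivity) hsum
    rw [Finset.sum_pair hne] at h
    have : 0 < 1 / (‖v‖ ^ 2) ^ s := by positivity
    exact lt_of_lt_of_le (lt_add_of_pos_right _ this) h
  have hB : 0 < B :=
    lt_of_lt_of_le (show 0 < 1 / (‖w‖ ^ 2) ^ (s + 1) by positivity)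
      (le_hasSum hsum' ⟨w, hw⟩ fun a _ => by positivity)
  have hs0 : (s : ℝ) ≠ 0 := by positivity
  constructor
  · have h0 : 0 < 1 / (‖w‖ ^ 2) ^ s := by positivity
    have h1 := Real.rpow_lt_rpow_of_neg h0 hA
      (show -(1 / (s : ℝ)) < 0 by
        have : 0 < 1 / (s : ℝ) := by positivity
        linarith)
    refine h1.trans_le (le_of_eq ?_)
    rw [one_div, Real.inv_rpow (by positivity), Real.rpow_neg (by positivity), inv_inv, one_div,
      Real.pow_rpow_inv_natCast (by positivity) (by omega)]
  · rw [lt_div_iff₀ hB]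
    -- Termwise `‖w‖²/‖a‖^(2s+2) ≤ 1/‖a‖^(2s)`, strictly at `a = v`.
    refine hasSum_lt (i := ⟨v, hv⟩) (fun a => ?_) ?_ (hsum'.mul_left (‖w‖ ^ 2)) hsum
    · have ha := hpos a a.2
      have hle := hmin a a.2
      rw [pow_succ _ s, ← div_eq_mul_one_div, div_le_div_iff₀ (by positivity) (by positivity), one_mul,
        mul_comm]
      gcongr
    · simp only
      rw [pow_succ _ s, ← div_eq_mul_one_div, div_lt_div_iff₀ (by positivity) (by positivity), one_mul,
        mul_comm]
      gcongr

end Coulomb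

end

/-! ### The theorem -/

theorem mainTheorem6 (L η : ℝ) (hL : -1 < L) (hη : η < 0) :
    ∃ Z : ℕ → ℝ,
      (∀ k : ℕ, 2 ≤ k →
        HasSum (fun ρ : coulombDerivZeros L η => 1 / (ρ : ℂ) ^ k) ((Z k : ℝ) : ℂ)) ∧
      (∀ s : ℕ, 1 ≤ s →
        Z (2 * s) ^ (-(1 / (s : ℝ))) < starlikeRadius 0 (coulombf L η) ^ 2 ∧
        starlikeRadius 0 (coulombf L η) ^ 2 < Z (2 * s) / Z (2 * s + 2)) ∧
      (L ≠ 0 →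
        (∀ᶠ ρ : ℝ in nhds 0,
          HasSum (fun n : ℕ => genCoeff L η n * ρ ^ n)
            (2 * (ρ - η) / (ρ ^ 2 - 2 * η * ρ - L * (L + 1)))) ∧
        genCoeff L η 0 = 2 * η / (L * (L + 1)) ∧
        genCoeff L η 1 = -(2 * (L ^ 2 + L + 2 * η ^ 2) / (L ^ 2 * (L + 1) ^ 2)) ∧
        genCoeff L η 2 = 2 * η * (3 * L ^ 2 + 3 * L + 4 * η ^ 2) / (L ^ 3 * (L + 1) ^ 3) ∧
        (2 * L + 3) * Z 2 =
          1 - L * genCoeff L η 1 - coulombP L η * genCoeff L η 0 + coulombP L η ^ 2 ∧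
        (2 * L + 4) * Z 3 =
          -L * genCoeff L η 2 - coulombP L η * genCoeff L η 1 + genCoeff L η 0 * Z 2
            - 2 * coulombP L η * Z 2 ∧
        ∀ n : ℕ,
          (2 * L + n + 5) * Z (n + 4) =
            -L * genCoeff L η (n + 3) - coulombP L η * genCoeff L η (n + 2)
              + ∑ m ∈ Finset.range (n + 2), genCoeff L η m * Z (3 + n - m)
              + ∑ m ∈ Finset.range (n + 1), Z (m + 2) * Z (n - m + 2)
              - 2 * coulombP L η * Z (n + 3)) := by
  -- `Z k = Y_{k-1}`, since `1/(a - z)` has coefficient `1/a^k` at `z^(k-1)`. The values `Z 0 = Z 1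
  -- = -p̃` are not power sums, but only indices at least `2` occur in the claims.
  refine ⟨fun k => PowerSeries.coeff (k - 1) (coulombLogSeries L η), fun k hk => ?_,
    fun s hs => ?_, fun hL0 => ⟨eventually_hasSum_genCoeff hL hL0, genCoeff_zero hL hL0,
      genCoeff_one hL hL0, genCoeff_two hL hL0, ?_, ?_,
      fun n => coulombLogSeries_recurrence_add_three hL hL0 n⟩⟩
  · have h := hasSum_inv_coulombG_zeros (η := η) hL (show 1 ≤ k - 1 by omega)
    rw [show k - 1 + 1 = k by omega] at h
    rw [coulombDerivZeros_eq hL]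
    exact h
  · obtain ⟨w, hw, hmin⟩ := exists_coulombG_zero_norm_minimal (η := η) hL
    rw [starlikeRadius_coulombf hL hη hw hmin]
    exact euler_rayleigh_coulombG hL hw hmin hs
  · have h := coeff_coulombLogSeries_recurrence (η := η) hL hL0 0
    have h0 := coeff_zero_coulombLogSeries (η := η) hL
    simp only [zero_add, Finset.sum_range_one, Nat.sub_self, h0, if_true, Nat.cast_zero,
      add_zero] at h
    simp only [Nat.add_one_sub_one]
    linear_combination h
  · have h := coeff_coulombLogSeries_recurrence (η := η) hL hL0 1
    have h0 := coeff_zero_coulombLogSeries (η := η) hL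
    simp only [Finset.sum_range_succ, Finset.sum_range_zero, Nat.sub_self, Nat.sub_zero, h0,
      one_ne_zero, if_false, Nat.cast_one, zero_add, Nat.reduceAdd] at h
    simp only [Nat.reduceSub]
    linear_combination h
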